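/- Let $(M,g)$ be a compact Riemannian manifold (smooth, without boundary), let $L$ be a Hermitian line bundle over $M$, and let $\nabla$ be a Hermitian connection on $L$. Let $G$ be a finite group that acts on $L$ by smooth maps carrying fibers complex-linearly to fibers, preserving $\nabla$, and such that the induced action on $M$ is by isometries. Let $\Gamma_1,\Gamma_2$ be subgroups of $G$ whose actions on $M$ are free, and suppose that they are almost conjugate in $G$, i.e. there is a bijection $\Gamma_1\to\Gamma_2$ carrying each element to an element conjugate to it in $G$. For $i=1,2$ let $L_i:=\Gamma_i\backslash L$ be the quotient line bundle over the Riemannian manifold $M_i:=\Gamma_i\backslash M$, and let $\nabla_i$ be the connection on $L_i$ induced by $\nabla$. Let $Q\in C^\infty(M)$ be a real-valued $G$-invariant function, and use the same letter $Q$ for the functions induced on $M_1$ and $M_2$. For a line bundle $E$ with connection $D$ over a closed Riemannian manifold $N$, a real-valued function $q\in C^\infty(N)$ and a positive integer $k$, let $\operatorname{Spec}(q;E,D,k)$ denote the spectrum of $\Delta+q$ on the smooth sections of $E^{\otimes k}$, that is, the collection of its eigenvalues counted with multiplicities; here $\Delta=-\operatorname{trace}(D^2)$ is the Laplacian of the connection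 that $D$ induces on $E^{\otimes k}$ (the second covariant derivative being formed with the Levi-Civita connection of $N$). Assume moreover that there is a bundle map $\sigma$ of $L$ (a smooth line bundle automorphism of $L$), projecting to an isometry of $M$, such that $\sigma$ normalizes $G$ and $\sigma\Gamma_1\sigma^{-1}=\Gamma_2$ (as groups of transformations of $L$). Denote also by $\sigma$ the induced isometry $M_1\to M_2$ and the induced bundle map $L_1\to L_2$. Then $$\operatorname{Spec}(Q;L_1,\nabla_1,k)=\operatorname{Spec}(\sigma^*Q;L_1,\sigma^*\nabla_2,k)$$ for all positive integers $k$. -/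

import Mathlib

open scoped Manifold ContDiff Bundle TensorProduct
open Bundle MulAction

noncomputable section

namespace LineBundleSunada

/-! ## Spectra of Schrödinger operators on tensor powers of a line bundle

Here `N` is an `n`-dimensional manifold and `V` a family of complex vector spaces over `N`, whose
total space `TotalSpace ℂ V` carries the structure of a manifold modelled on `ℝⁿ × ℂ`. -/

section Spectrum

variable {n : ℕ} {N : Type*} [TopologicalSpace N] [ChartedSpace (EuclideanSpace ℝ (Fin n)) N]
  {V : N → Type*} [∀ y, AddCommGroup (V y)] [∀ y, Module ℂ (V y)]
  [TopologicalSpace (TotalSpace ℂ V)]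
  [ChartedSpace (ModelProd (EuclideanSpace ℝ (Fin n)) ℂ) (TotalSpace ℂ V)]

variable (n) in
/-- The section `s` of `V` is smooth at `y`, as a map into the total space. -/
def SmoothSectionAt (s : Π y, V y) (y : N) : Prop :=
  ContMDiffAt (𝓡 n) ((𝓡 n).prod 𝓘(ℝ, ℂ)) ∞ (fun z => TotalSpace.mk' ℂ z (s z)) y

variable (n) in
/-- `e` is a smooth local frame of the line bundle `V` near `y`: it is smooth near `y` and does not
vanish at `y`. -/
def IsFrameAt (e : Π y, V y) (y : N) : Prop :=
  (∀ᶠ z in nhds y, SmoothSectionAt n e z) ∧ e y ≠ 0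

/-- The fibre at `y` of the `k`-th tensor power of `V`. -/
abbrev TensorFiber (V : N → Type*) [∀ y, AddCommGroup (V y)] [∀ y, Module ℂ (V y)] (k : ℕ) (y : N) :
    Type _ :=
  ⨂[ℂ] _i : Fin k, V y

/-- The section `e ⊗ ⋯ ⊗ e` of the `k`-th tensor power. -/
def framePow (k : ℕ) (e : Π y, V y) (y : N) : TensorFiber V k y :=
  PiTensorProduct.tprod ℂ fun _ : Fin k => e y

open Classical in
/-- The coordinate function `f` of a section `t = f • (e ⊗ ⋯ ⊗ e)` of the `k`-th tensor power with
respect to the frame `e` (and `0` at points where `t` is not a multiple of `e ⊗ ⋯ ⊗ e`). -/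
def frameCoord (k : ℕ) (e : Π y, V y) (t : Π y, TensorFiber V k y) (y : N) : ℂ :=
  if h : ∃ c : ℂ, t y = c • framePow k e y then h.choose else 0

variable (n) in
/-- A section of the `k`-th tensor power of `V` is smooth if its coordinate functions with respect
to the frames `e ⊗ ⋯ ⊗ e` are smooth, for `e` a smooth local frame of `V`. -/
def IsSmoothTensorSection (k : ℕ) (t : Π y, TensorFiber V k y) : Prop :=
  ∀ (y : N) (e : Π y, V y), IsFrameAt n e y →
    ContMDiffAt (𝓡 n) 𝓘(ℝ, ℂ) ∞ (frameCoord k e t) y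

variable (n V) in
/-- The underlying data of a connection: `D s y w` is the covariant derivative of the section `s`
at the point `y` in the direction of the tangent vector `w`. -/
abbrev Conn : Type _ :=
  (Π y : N, V y) → Π y : N, TangentSpace (𝓡 n) y → V y

open Classical in
variable (n) in
/-- A smooth local frame of `V` near `y`. -/
def chosenFrame (V : N → Type*) [∀ y, AddCommGroup (V y)] [∀ y, Module ℂ (V y)]
    [TopologicalSpace (TotalSpace ℂ V)]
    [ChartedSpace (ModelProd (EuclideanSpace ℝ (Fin n)) ℂ) (TotalSpace ℂ V)] (y : N) : Π z, V z :=
  if h : ∃ e : Π z, V z, IsFrameAt n e y then h.choose else 0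

/-- The connection induced by `D` on the `k`-th tensor power, given by the Leibniz rule: with
`t = f • (e ⊗ ⋯ ⊗ e)` near `y`,
`D_w t = df(w) • (e ⊗ ⋯ ⊗ e) + f • ∑ⱼ e ⊗ ⋯ ⊗ D_w e ⊗ ⋯ ⊗ e`, with `D_w e` in the `j`-th place.
The value does not depend on the local frame `e`. -/
def tensorConn (D : Conn n V) (k : ℕ) (t : Π y, TensorFiber V k y) (y : N)
    (w : TangentSpace (𝓡 n) y) : TensorFiber V k y :=
  let e := chosenFrame n V y
  let f := frameCoord k e t
  let df : TangentSpace (𝓡 n) y →L[ℝ] ℂ := mfderiv (𝓡 n) 𝓘(ℝ, ℂ) f y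
  df w • framePow k e y +
    f y • ∑ j : Fin k, PiTensorProduct.tprod ℂ (Function.update (fun _ : Fin k => e y) j (D e y w))

/-- The `i`-th coordinate vector field of the chart `φ`. -/
def coordField (φ : OpenPartialHomeomorph N (EuclideanSpace ℝ (Fin n))) (i : Fin n) (y : N) :
    TangentSpace (𝓡 n) y :=
  (mfderiv (𝓡 n) (𝓡 n) φ y).inverse (EuclideanSpace.single i (1 : ℝ))

/-- The partial derivative of a real function in the direction of the `i`-th coordinate field. -/
def coordDeriv (φ : OpenPartialHomeomorph N (EuclideanSpace ℝ (Fin n))) (i : Fin n) (u : N → ℝ)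
    (y : N) : ℝ :=
  let du : TangentSpace (𝓡 n) y →L[ℝ] ℝ := mfderiv (𝓡 n) 𝓘(ℝ, ℝ) u y
  du (coordField φ i y)

variable (n N) in
/-- The underlying data of a Riemannian metric. -/
abbrev MetricData : Type _ :=
  Π y : N, TangentSpace (𝓡 n) y → TangentSpace (𝓡 n) y → ℝ

/-- The matrix `(h_ij)` of the metric `h` in the chart `φ`. -/
def gram (h : MetricData n N) (φ : OpenPartialHomeomorph N (EuclideanSpace ℝ (Fin n))) (y : N) :
    Matrix (Fin n) (Fin n) ℝ :=
  Matrix.of fun i j => h y (coordField φ i y) (coordField φ j y)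

/-- The Christoffel symbol `Γ^l_ij` of the Levi-Civita connection of `h` in the chart `φ`. -/
def christoffel (h : MetricData n N) (φ : OpenPartialHomeomorph N (EuclideanSpace ℝ (Fin n)))
    (l i j : Fin n) (y : N) : ℝ :=
  (1 / 2) * ∑ m : Fin n, (gram h φ y)⁻¹ l m *
    (coordDeriv φ i (fun z => gram h φ z m j) y + coordDeriv φ j (fun z => gram h φ z m i) y
      - coordDeriv φ m (fun z => gram h φ z i j) y)

/-- The Laplacian `Δ t = - trace (∇² t)` on sections of the `k`-th tensor power, in the chart `φ`:
`Δ t = - ∑ᵢⱼ h^ij (∇_i ∇_j t - ∑ₗ Γ^l_ij ∇_l t)`. -/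
def laplacianIn (h : MetricData n N) (D : Conn n V) (k : ℕ)
    (φ : OpenPartialHomeomorph N (EuclideanSpace ℝ (Fin n))) (t : Π y, TensorFiber V k y) (y : N) :
    TensorFiber V k y :=
  - ∑ i : Fin n, ∑ j : Fin n, (((gram h φ y)⁻¹ i j : ℝ) : ℂ) •
      (tensorConn D k (fun z => tensorConn D k t z (coordField φ j z)) y (coordField φ i y)
        - ∑ l : Fin n, (christoffel h φ l i j y : ℂ) • tensorConn D k t y (coordField φ l y))

/-- `t` is a smooth section of the `k`-th tensor power with `(Δ + Q) t = z t`, where the equation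
is required in all smooth charts. -/
def IsEigensection (h : MetricData n N) (D : Conn n V) (k : ℕ) (Q : N → ℝ) (z : ℂ)
    (t : Π y, TensorFiber V k y) : Prop :=
  IsSmoothTensorSection n k t ∧
    ∀ φ ∈ IsManifold.maximalAtlas (𝓡 n) ∞ N, ∀ y ∈ φ.source,
      laplacianIn h D k φ t y + (Q y : ℂ) • t y = z • t y

/-- The spectrum of `Δ + Q` on the smooth sections of the `k`-th tensor power of `V`, counted with
multiplicities: it maps `z` to the dimension of the space of sections `t` with `(Δ + Q) t = z t`.
(These sections already form a subspace, so the span is only a way to speak of its dimension.) -/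
def spec (h : MetricData n N) (D : Conn n V) (k : ℕ) (Q : N → ℝ) : ℂ → Cardinal :=
  fun z => Module.rank ℂ (Submodule.span ℂ {t : Π y, TensorFiber V k y | IsEigensection h D k Q z t})

end Spectrum

/-! ## Line bundles with a group action, and their quotients -/

section TotalSpace

variable {B F : Type*} [TopologicalSpace B] [TopologicalSpace F] {E : B → Type*}
  [TopologicalSpace (TotalSpace F E)] [∀ b, TopologicalSpace (E b)] [FiberBundle F E]

instance totalSpace_t2Space [T2Space B] [T2Space F] : T2Space (TotalSpace F E) := by
  refine ⟨fun v w hvw => ?_⟩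
  by_cases h : v.proj = w.proj
  · let e := trivializationAt F E v.proj
    have hv : v ∈ e.source := FiberBundle.mem_trivializationAt_proj_source
    have hw : w ∈ e.source := by
      rw [e.mem_source, ← h]; exact FiberBundle.mem_baseSet_trivializationAt' _
    have hne : e v ≠ e w := fun h' => hvw (e.injOn hv hw h')
    obtain ⟨U, W, hU, hW, hvU, hwW, hd⟩ := t2_separation hne
    refine ⟨e.source ∩ e ⁻¹' U, e.source ∩ e ⁻¹' W,
      e.continuousOn_toFun.isOpen_inter_preimage e.open_source hU,
      e.continuousOn_toFun.isOpen_inter_preimage e.open_source hW, ⟨hv, hvU⟩, ⟨hw, hwW⟩, ?_⟩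
    exact ((hd.preimage e).mono Set.inter_subset_right Set.inter_subset_right)
  · obtain ⟨U, W, hU, hW, hvU, hwW, hd⟩ := t2_separation h
    exact ⟨_, _, hU.preimage (FiberBundle.continuous_proj F E),
      hW.preimage (FiberBundle.continuous_proj F E), hvU, hwW, hd.preimage _⟩

instance totalSpace_locallyCompactSpace [LocallyCompactSpace B] [LocallyCompactSpace F] :
    LocallyCompactSpace (TotalSpace F E) :=
  ChartedSpace.locallyCompactSpace (B × F) (TotalSpace F E)

end TotalSpace

section Quotient

variable {M : Type*} (L : M → Type*) [∀ x, AddCommGroup (L x)] [∀ x, Module ℂ (L x)]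

/-- The map `Φ` of the total space of `L` maps the fibre over `x` by a complex linear map to the
fibre over `φ x`. -/
def IsFiberwiseLinear (Φ : TotalSpace ℂ L → TotalSpace ℂ L) (φ : M → M) : Prop :=
  ∀ x, ∃ A : L x →ₗ[ℂ] L (φ x), ∀ v : L x, Φ ⟨x, v⟩ = ⟨φ x, A v⟩

/-- The action of `G` on the total space of `L` carries fibers to fibers by complex linear maps,
and it induces the given action on the base. -/
class IsLineBundleAction (G : Type*) [Group G] [MulAction G M] [MulAction G (TotalSpace ℂ L)] :
    Prop where
  isFiberwiseLinear : ∀ g : G, IsFiberwiseLinear L (fun v => g • v) (fun x => g • x)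

variable {L} in
theorem proj_smul {G : Type*} [Group G] [MulAction G M] [MulAction G (TotalSpace ℂ L)]
    [IsLineBundleAction L G] (g : G) (v : TotalSpace ℂ L) : (g • v).proj = g • v.proj := by
  obtain ⟨A, hA⟩ := IsLineBundleAction.isFiberwiseLinear (L := L) g v.proj
  exact congrArg TotalSpace.proj (hA v.2)

instance isLineBundleAction_subgroup (G : Type*) [Group G] [MulAction G M]
    [MulAction G (TotalSpace ℂ L)] [IsLineBundleAction L G] (Γ : Subgroup G) :
    IsLineBundleAction L Γ :=
  ⟨fun g => IsLineBundleAction.isFiberwiseLinear (g : G)⟩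

instance continuousConstSMul_subgroup (G X : Type*) [Group G] [MulAction G X] [TopologicalSpace X]
    [ContinuousConstSMul G X] (Γ : Subgroup G) : ContinuousConstSMul Γ X :=
  ⟨fun γ => continuous_const_smul (γ : G)⟩

variable (Γ : Type*) [Group Γ] [MulAction Γ M] [MulAction Γ (TotalSpace ℂ L)]
  [IsLineBundleAction L Γ]

/-- The projection `Γ\L → Γ\M`. -/
def quotProj : orbitRel.Quotient Γ (TotalSpace ℂ L) → orbitRel.Quotient Γ M :=
  Quotient.map TotalSpace.proj (by
    rintro v w ⟨γ, rfl⟩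
    exact ⟨γ, (proj_smul γ w).symm⟩)

/-- The fibre of `Γ\L → Γ\M` over `q`. -/
def QuotFiber (q : orbitRel.Quotient Γ M) : Type _ :=
  {v : orbitRel.Quotient Γ (TotalSpace ℂ L) // quotProj L Γ v = q}

/-- The map from the fibre of `L` over `x` to the fibre of `Γ\L` over the class of `x`. -/
def toQuotFiber (x : M) (q : orbitRel.Quotient Γ M) (h : Quotient.mk _ x = q) (v : L x) :
    QuotFiber L Γ q :=
  ⟨Quotient.mk _ (⟨x, v⟩ : TotalSpace ℂ L), h⟩

variable [IsCancelSMul Γ M]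

theorem toQuotFiber_bijective (x : M) (q : orbitRel.Quotient Γ M) (h : Quotient.mk _ x = q) :
    Function.Bijective (toQuotFiber L Γ x q h) := by
  constructor
  · intro v w hvw
    obtain ⟨γ, hγ⟩ := Quotient.exact (congrArg Subtype.val hvw)
    have hγ' : γ • (⟨x, w⟩ : TotalSpace ℂ L) = ⟨x, v⟩ := hγ
    have h1 : γ • x = x := by
      have := congrArg TotalSpace.proj hγ'
      rwa [proj_smul] at this
    obtain rfl : γ = 1 := IsCancelSMul.eq_one_of_smul h1
    rw [one_smul] at hγ'
    simpa using hγ'.symm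
  · rintro ⟨u, hu⟩
    induction u using Quotient.inductionOn with | h u => ?_
    subst h
    obtain ⟨γ, hγ⟩ := Quotient.exact hu.symm
    have hγ' : γ • u.proj = x := hγ
    obtain ⟨A, hA⟩ := IsLineBundleAction.isFiberwiseLinear (L := L) γ u.proj
    subst hγ'
    refine ⟨A u.2, Subtype.ext (Quotient.sound ⟨γ, ?_⟩)⟩
    exact hA u.2

/-- The fibre of `L` over `x` is identified with the fibre of `Γ\L` over the class of `x`. -/
def fiberEquiv (x : M) (q : orbitRel.Quotient Γ M) (h : Quotient.mk _ x = q) :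
    L x ≃ QuotFiber L Γ q :=
  Equiv.ofBijective _ (toQuotFiber_bijective L Γ x q h)

instance (q : orbitRel.Quotient Γ M) : AddCommGroup (QuotFiber L Γ q) :=
  (fiberEquiv L Γ q.out q q.out_eq).symm.addCommGroup

instance (q : orbitRel.Quotient Γ M) : Module ℂ (QuotFiber L Γ q) :=
  (fiberEquiv L Γ q.out q q.out_eq).symm.module ℂ

/-- The vector space structure on the fibers of `Γ\L` does not depend on the choice of
representatives: all the identifications `fiberEquiv` are linear. -/
theorem fiberEquiv_linear (x : M) (q : orbitRel.Quotient Γ M) (h : Quotient.mk _ x = q) :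
    IsLinearMap ℂ (fiberEquiv L Γ x q h) := by
  obtain ⟨γ, hγ⟩ := Quotient.exact (q.out_eq.trans h.symm)
  have hγ' : γ • x = q.out := hγ
  obtain ⟨A, hA⟩ := IsLineBundleAction.isFiberwiseLinear (L := L) γ x
  let e := fiberEquiv L Γ q.out q q.out_eq
  have key : ∀ (y : M) (hy : γ • x = y) (hq : Quotient.mk _ y = q), ∃ B : L x →ₗ[ℂ] L y,
      ∀ v, fiberEquiv L Γ x q h v = fiberEquiv L Γ y q hq (B v) := by
    rintro y rfl hq
    refine ⟨A, fun v => Subtype.ext ?_⟩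
    have hs : orbitRel Γ (TotalSpace ℂ L) ⟨γ • x, A v⟩ ⟨x, v⟩ := ⟨γ, hA v⟩
    exact (Quotient.sound hs).symm
  obtain ⟨B, hB⟩ := key _ hγ' q.out_eq
  refine ⟨fun v w => ?_, fun c v => ?_⟩
  · rw [hB, hB, hB, map_add]
    exact map_add e.symm.addEquiv.symm (B v) (B w)
  · rw [hB, hB, map_smul]
    exact map_smul (e.symm.linearEquiv ℂ).symm c (B v)

instance isCancelSMul_totalSpace : IsCancelSMul Γ (TotalSpace ℂ L) where
  left_cancel' γ _ _ h := smul_left_cancel γ h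
  right_cancel' γ γ' v h := by
    have := congrArg TotalSpace.proj h
    rw [proj_smul, proj_smul] at this
    exact IsCancelSMul.right_cancel _ _ _ this

/-- The total space of the family of fibers of `Γ\L` is the orbit space of the total space
of `L`. -/
def quotTotalSpaceEquiv :
    orbitRel.Quotient Γ (TotalSpace ℂ L) ≃ TotalSpace ℂ (QuotFiber L Γ) where
  toFun v := ⟨quotProj L Γ v, ⟨v, rfl⟩⟩
  invFun v := v.2.1
  left_inv _ := rfl
  right_inv := by
    rintro ⟨q, ⟨v, rfl⟩⟩
    rfl

end Quotient

section QuotientManifold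

variable {n : ℕ} {M : Type*} [TopologicalSpace M] [ChartedSpace (EuclideanSpace ℝ (Fin n)) M]
  [T2Space M] [LocallyCompactSpace M]
  (L : M → Type*) [TopologicalSpace (TotalSpace ℂ L)]
  [∀ x, AddCommGroup (L x)] [∀ x, Module ℂ (L x)] [∀ x, TopologicalSpace (L x)] [FiberBundle ℂ L]
  (Γ : Type*) [Group Γ] [Finite Γ] [MulAction Γ M] [MulAction Γ (TotalSpace ℂ L)]
  [ContinuousConstSMul Γ M] [ContinuousConstSMul Γ (TotalSpace ℂ L)]
  [IsLineBundleAction L Γ] [IsCancelSMul Γ M]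

instance quotTotalSpace_topology : TopologicalSpace (TotalSpace ℂ (QuotFiber L Γ)) :=
  (quotTotalSpaceEquiv L Γ).symm.topologicalSpace

/-- The total space of `Γ\L` is a manifold, as the orbit space of the manifold `L`. -/
instance quotTotalSpace_chartedSpace :
    ChartedSpace (ModelProd (EuclideanSpace ℝ (Fin n)) ℂ) (TotalSpace ℂ (QuotFiber L Γ)) :=
  (quotTotalSpaceEquiv L Γ).symm.homeomorph.symm.chartedSpace

variable (M) in
/-- The inverse of the differential of `M → Γ\M` at the chosen representative of `q`. -/
def quotDerivInv (q : orbitRel.Quotient Γ M) :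
    TangentSpace (𝓡 n) q →L[ℝ] TangentSpace (𝓡 n) q.out :=
  (mfderiv (𝓡 n) (𝓡 n) (Quotient.mk (orbitRel Γ M)) q.out).inverse

/-- The metric on `Γ\M` for which `M → Γ\M` is a local isometry (if `Γ` acts by isometries). -/
def quotMetric [IsManifold (𝓡 n) ∞ M]
    (g : ContMDiffRiemannianMetric (𝓡 n) ∞ (EuclideanSpace ℝ (Fin n))
      (fun x : M => TangentSpace (𝓡 n) x)) : MetricData n (orbitRel.Quotient Γ M) :=
  fun q v w => g.inner q.out (quotDerivInv M Γ q v) (quotDerivInv M Γ q w)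

variable {L Γ} in
/-- The pullback of a section of `Γ\L` to a (`Γ`-invariant) section of `L`. -/
def liftSection (s : Π q, QuotFiber L Γ q) (x : M) : L x :=
  (fiberEquiv L Γ x _ rfl).symm (s (Quotient.mk _ x))

variable [∀ x, IsTopologicalAddGroup (L x)] [∀ x, ContinuousSMul ℝ (L x)] in
/-- The connection on `Γ\L` induced by a `Γ`-invariant connection on `L`. -/
def quotConn (D : CovariantDerivative (𝓡 n) ℂ L) : Conn n (QuotFiber L Γ) :=
  fun s q w =>
    fiberEquiv L Γ q.out q q.out_eq (D (liftSection s) q.out (quotDerivInv M Γ q w))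

end QuotientManifold

/-- The function on `Γ\M` induced by a `Γ`-invariant function on `M`. -/
def quotFun {M Γ : Type*} [Group Γ] [MulAction Γ M] (Q : M → ℝ)
    (hQ : ∀ (γ : Γ) (x : M), Q (γ • x) = Q x) : orbitRel.Quotient Γ M → ℝ :=
  Quotient.lift Q (by rintro _ x ⟨γ, rfl⟩; exact hQ γ x)

/-- `Γ₁` and `Γ₂` are almost conjugate in `G`: there is a bijection from `Γ₁` to `Γ₂` carrying each
element to a conjugate element. -/
def AlmostConjugate {G : Type*} [Group G] (Γ₁ Γ₂ : Subgroup G) : Prop :=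
  ∃ e : Γ₁ ≃ Γ₂, ∀ γ : Γ₁, IsConj (γ : G) (e γ : G)

section Geometry

variable {n : ℕ} {M : Type*} [TopologicalSpace M] [ChartedSpace (EuclideanSpace ℝ (Fin n)) M]
  {L : M → Type*} [TopologicalSpace (TotalSpace ℂ L)]
  [∀ x, AddCommGroup (L x)] [∀ x, Module ℂ (L x)] [∀ x, TopologicalSpace (L x)] [FiberBundle ℂ L]

/-- The map `f` is smooth and its differential preserves the Riemannian metric `g`. -/
def IsSmoothIsometry [IsManifold (𝓡 n) ∞ M]
    (g : ContMDiffRiemannianMetric (𝓡 n) ∞ (EuclideanSpace ℝ (Fin n))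
      (fun x : M => TangentSpace (𝓡 n) x)) (f : M → M) : Prop :=
  ContMDiff (𝓡 n) (𝓡 n) ∞ f ∧ ∀ (x : M) (v w : TangentSpace (𝓡 n) x),
    g.inner (f x) (mfderiv (𝓡 n) (𝓡 n) f x v) (mfderiv (𝓡 n) (𝓡 n) f x w) = g.inner x v w

variable (n L) in
/-- A smooth Hermitian metric on the complex line bundle `L`. -/
structure HermitianMetric where
  inner (x : M) : L x →ₗ⋆[ℂ] L x →ₗ[ℂ] ℂ
  conj_symm (x : M) (v w : L x) : starRingEnd ℂ (inner x v w) = inner x w v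
  pos (x : M) (v : L x) (hv : v ≠ 0) : 0 < (inner x v v).re
  smooth (s t : Π x, L x) (x : M) (hs : SmoothSectionAt n s x) (ht : SmoothSectionAt n t x) :
    ContMDiffAt (𝓡 n) 𝓘(ℝ, ℂ) ∞ (fun y => inner y (s y) (t y)) x

variable (n L) in
/-- A bundle map of the line bundle `L` (a smooth vector bundle automorphism), given by its action
on the total space and the induced diffeomorphism of the base. -/
structure BundleAut where
  total : Equiv.Perm (TotalSpace ℂ L)
  base : Equiv.Perm M
  isFiberwiseLinear : IsFiberwiseLinear L total base
  contMDiff_total : ContMDiff ((𝓡 n).prod 𝓘(ℝ, ℂ)) ((𝓡 n).prod 𝓘(ℝ, ℂ)) ∞ total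
  contMDiff_total_symm : ContMDiff ((𝓡 n).prod 𝓘(ℝ, ℂ)) ((𝓡 n).prod 𝓘(ℝ, ℂ)) ∞ total.symm
  contMDiff_base : ContMDiff (𝓡 n) (𝓡 n) ∞ base
  contMDiff_base_symm : ContMDiff (𝓡 n) (𝓡 n) ∞ base.symm

variable [∀ x, IsTopologicalAddGroup (L x)] [∀ x, ContinuousSMul ℝ (L x)]

/-- `D` is a smooth Hermitian connection on the line bundle `L` with Hermitian metric `h`: it is
smooth and complex linear, and `d(h(s, t)) = h(D s, t) + h(s, D t)`. -/
structure IsHermitianConnection [IsManifold (𝓡 n) ∞ M] [VectorBundle ℝ ℂ L]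
    (h : HermitianMetric n L) (D : CovariantDerivative (𝓡 n) ℂ L) : Prop where
  smooth : D.ContMDiffCovariantDerivative ∞
  complexLinear (s : Π x, L x) (x : M) (w : TangentSpace (𝓡 n) x) (c : ℂ) :
    SmoothSectionAt n s x → D (fun y => c • s y) x w = c • D s x w
  metric (s t : Π x, L x) (x : M) (w : TangentSpace (𝓡 n) x) :
    SmoothSectionAt n s x → SmoothSectionAt n t x →
      (mfderiv (𝓡 n) 𝓘(ℝ, ℂ) (fun y => h.inner y (s y) (t y)) x : TangentSpace (𝓡 n) x →L[ℝ] ℂ) w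
        = h.inner x (D s x w) (t x) + h.inner x (s x) (D t x w)

/-- The fiberwise linear bijection `Φ` of the total space of `L`, covering `φ`, preserves the
connection `D`: if it maps the section `s` to the section `t`, then it maps `D_w s` to
`D_{dφ(w)} t`. -/
def PreservesConnection (D : CovariantDerivative (𝓡 n) ℂ L)
    (Φ : TotalSpace ℂ L → TotalSpace ℂ L) (φ : M → M) : Prop :=
  ∀ s t : Π x, L x, (∀ x, Φ ⟨x, s x⟩ = ⟨φ x, t (φ x)⟩) →
    ∀ (x : M) (w : TangentSpace (𝓡 n) x), SmoothSectionAt n s x →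
      Φ ⟨x, D s x w⟩ = ⟨φ x, D t (φ x) (mfderiv (𝓡 n) (𝓡 n) φ x w)⟩

end Geometry

/-! ## Maps induced on quotients, and pullback of connections -/

/-- The pullback of a connection under a bundle isomorphism `Φ` covering `φ`: for a section `s`,
`(Φ^* D)_w s = Φ⁻¹ (D_{dφ(w)} (Φ ∘ s ∘ φ⁻¹))`. -/
def pullbackConn {n : ℕ} {N N' : Type*} [TopologicalSpace N]
    [ChartedSpace (EuclideanSpace ℝ (Fin n)) N] [TopologicalSpace N']
    [ChartedSpace (EuclideanSpace ℝ (Fin n)) N'] {V : N → Type*} {V' : N' → Type*}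
    (φ : N ≃ N') (Φ : ∀ y, V y ≃ V' (φ y)) (D : Conn n V') : Conn n V :=
  fun s y w => (Φ y).symm (D (φ.piCongr Φ s) (φ y) (mfderiv (𝓡 n) (𝓡 n) φ y w))

section Induced

variable {n : ℕ} {M : Type*} [TopologicalSpace M] [ChartedSpace (EuclideanSpace ℝ (Fin n)) M]
  {L : M → Type*} [TopologicalSpace (TotalSpace ℂ L)]
  [∀ x, AddCommGroup (L x)] [∀ x, Module ℂ (L x)] [∀ x, TopologicalSpace (L x)] [FiberBundle ℂ L]
  {G : Type*} [Group G] [MulAction G (TotalSpace ℂ L)]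

namespace BundleAut

variable (σ : BundleAut n L)

theorem proj_total (v : TotalSpace ℂ L) : (σ.total v).proj = σ.base v.proj := by
  obtain ⟨A, hA⟩ := σ.isFiberwiseLinear v.proj
  exact congrArg TotalSpace.proj (hA v.2)

/-- `σ Γ₁ σ⁻¹ = Γ₂`, as groups of transformations of the total space of `L`. -/
def Conjugates (Γ₁ Γ₂ : Subgroup G) : Prop :=
  (Γ₁.map (toPermHom G (TotalSpace ℂ L))).map (MulAut.conj σ.total).toMonoidHom
    = Γ₂.map (toPermHom G (TotalSpace ℂ L))

/-- `σ` normalizes `G`, as a group of transformations of the total space of `L`. -/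
def Normalizes (G : Type*) [Group G] [MulAction G (TotalSpace ℂ L)] : Prop :=
  σ.total ∈ Subgroup.normalizer ((toPermHom G (TotalSpace ℂ L)).range : Set _)

variable {σ} {Γ₁ Γ₂ : Subgroup G}

theorem Conjugates.orbitRel_total (h : σ.Conjugates Γ₁ Γ₂) (v w : TotalSpace ℂ L) :
    orbitRel Γ₁ (TotalSpace ℂ L) v w ↔
      orbitRel Γ₂ (TotalSpace ℂ L) (σ.total v) (σ.total w) := by
  constructor
  · rintro ⟨γ, rfl⟩
    have : (MulAut.conj σ.total) (toPermHom G _ γ) ∈ Γ₂.map (toPermHom G (TotalSpace ℂ L)) :=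
      h ▸ Subgroup.mem_map_of_mem _ (Subgroup.mem_map_of_mem _ γ.2)
    obtain ⟨γ', hγ', e⟩ := this
    refine ⟨⟨γ', hγ'⟩, ?_⟩
    have := congrArg (fun p : Equiv.Perm (TotalSpace ℂ L) => p (σ.total w)) e
    simpa [MulAut.conj_apply] using! this
  · rintro ⟨γ, e⟩
    have : toPermHom G _ γ ∈ (Γ₁.map (toPermHom G (TotalSpace ℂ L))).map
        (MulAut.conj σ.total).toMonoidHom := h ▸ Subgroup.mem_map_of_mem _ γ.2
    obtain ⟨_, ⟨γ', hγ', rfl⟩, e'⟩ := this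
    refine ⟨⟨γ', hγ'⟩, σ.total.injective ?_⟩
    have := congrArg (fun p : Equiv.Perm (TotalSpace ℂ L) => p (σ.total w)) e'
    refine Eq.trans ?_ (this.trans e)
    simp [MulAut.conj_apply]

/-- The map `Γ₁\L → Γ₂\L` induced by `σ`. -/
def Conjugates.total (h : σ.Conjugates Γ₁ Γ₂) :
    orbitRel.Quotient Γ₁ (TotalSpace ℂ L) ≃ orbitRel.Quotient Γ₂ (TotalSpace ℂ L) :=
  Quotient.congr σ.total h.orbitRel_total

variable [MulAction G M] [IsLineBundleAction L G]

theorem Conjugates.orbitRel_base (h : σ.Conjugates Γ₁ Γ₂) (x y : M) :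
    orbitRel Γ₁ M x y ↔ orbitRel Γ₂ M (σ.base x) (σ.base y) := by
  have aux : ∀ (Γ : Subgroup G) (v w : TotalSpace ℂ L),
      orbitRel Γ (TotalSpace ℂ L) v w → orbitRel Γ M v.proj w.proj := by
    rintro Γ v w ⟨γ, rfl⟩
    exact ⟨γ, (proj_smul γ w).symm⟩
  constructor
  · rintro ⟨γ, rfl⟩
    have := aux _ _ _ ((h.orbitRel_total (γ • (⟨y, 0⟩ : TotalSpace ℂ L)) ⟨y, 0⟩).1 ⟨γ, rfl⟩)
    rwa [proj_total, proj_total, proj_smul] at this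
  · rintro ⟨γ, e⟩
    have h1 := (h.orbitRel_total (σ.total.symm (γ • σ.total (⟨y, 0⟩ : TotalSpace ℂ L))) ⟨y, 0⟩).2
      (by rw [Equiv.apply_symm_apply]; exact ⟨γ, rfl⟩)
    have h2 := aux _ _ _ h1
    have h3 : (σ.total.symm (γ • σ.total (⟨y, 0⟩ : TotalSpace ℂ L))).proj = x := by
      apply σ.base.injective
      rw [← proj_total, Equiv.apply_symm_apply, proj_smul, proj_total]
      exact e
    rwa [h3] at h2

/-- The map `Γ₁\M → Γ₂\M` induced by `σ`. -/
def Conjugates.base (h : σ.Conjugates Γ₁ Γ₂) :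
    orbitRel.Quotient Γ₁ M ≃ orbitRel.Quotient Γ₂ M :=
  Quotient.congr σ.base h.orbitRel_base

theorem Conjugates.quotProj_total (h : σ.Conjugates Γ₁ Γ₂)
    (v : orbitRel.Quotient Γ₁ (TotalSpace ℂ L)) :
    quotProj L Γ₂ (h.total v) = h.base (quotProj L Γ₁ v) := by
  induction v using Quotient.inductionOn with | h v => ?_
  exact congrArg (Quotient.mk _) (σ.proj_total v)

/-- The map `Γ₁\L → Γ₂\L` induced by `σ`, on the fibers. -/
def Conjugates.fiber (h : σ.Conjugates Γ₁ Γ₂)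
    (q : orbitRel.Quotient Γ₁ M) : QuotFiber L Γ₁ q ≃ QuotFiber L Γ₂ (h.base q) :=
  h.total.subtypeEquiv fun v => by rw [h.quotProj_total, h.base.apply_eq_iff_eq]

end BundleAut

end Induced

end LineBundleSunada

end

noncomputable section

namespace LineBundleSunada

set_option linter.unusedSectionVars false

/-! ## Invariants of almost conjugate subgroups -/

section Representation

variable {G : Type*} [Group G]

/-! This is Sunada's argument. Fix `k` and `z`, and let E be the space of smooth sections t of the
k-th tensor power of L over M with (Δ + Q)t = zt. The group G preserves metric, connection and
potential, so it acts linearly on E (`eigenRep`), and pullback along L → Γ₁\L identifies the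
z-eigensections over M₁ with the invariants of Γ₁ in E. The operator over M₁ with connection σ^*∇₂
and potential σ^*Q is the operator over M₂ seen through σ. Pullback along v ↦ [σ⁻¹v] turns its data
into the same D and Q on M, and the fibers of x ↦ [σ⁻¹x] are the Γ₂-orbits because σΓ₁σ⁻¹ = Γ₂;
hence its z-eigensections are the invariants of Γ₂ in the same E. Invariants of almost conjugate
subgroups have equal dimension in every complex representation of G, so the multiplicities agree.

The algebra ends in `AlmostConjugate.rank_invariants_eq`. Multiplicities are cardinals, and
Maschke's theorem reduces an arbitrary representation to the finite dimensional case, where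
characters decide; no finiteness of eigenspaces enters.

The analysis is concentrated in `IsLocalIso`: a surjective local diffeomorphism, covered by
fiberwise linear isomorphisms, that matches all the data. Such a map preserves and reflects
eigensections (`IsLocalIso.isEigensection_iff`), and sections descend along it when they are
invariant (`IsLocalIso.nonempty_linearEquiv_invariants`). The three instances needed are
`isLocalIso_smul`, `isLocalIso_quot` and `isLocalIso_symmQuot`. -/

theorem AlmostConjugate.symm {Γ₁ Γ₂ : Subgroup G} (h : AlmostConjugate Γ₁ Γ₂) :
    AlmostConjugate Γ₂ Γ₁ := by
  obtain ⟨e, he⟩ := h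
  refine ⟨e.symm, fun γ => ?_⟩
  simpa using (he (e.symm γ)).symm

variable [Finite G]

/-- In a finite dimensional representation, the invariants of almost conjugate subgroups have the
same dimension. -/
theorem AlmostConjugate.finrank_invariants {Γ₁ Γ₂ : Subgroup G} (h : AlmostConjugate Γ₁ Γ₂)
    {V : Type*} [AddCommGroup V] [Module ℂ V] [FiniteDimensional ℂ V] (ρ : Representation ℂ G V) :
    Module.finrank ℂ (Representation.invariants (ρ.comp Γ₁.subtype)) =
      Module.finrank ℂ (Representation.invariants (ρ.comp Γ₂.subtype)) := by
  classical
  obtain ⟨e, he⟩ := h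
  have := Fintype.ofFinite G
  have : Fintype Γ₁ := Fintype.ofFinite _
  have : Fintype Γ₂ := Fintype.ofFinite _
  have i1 : Invertible (Nat.card Γ₁ : ℂ) :=
    invertibleOfNonzero (Nat.cast_ne_zero.2 Nat.card_pos.ne')
  have i2 : Invertible (Nat.card Γ₂ : ℂ) :=
    invertibleOfNonzero (Nat.cast_ne_zero.2 Nat.card_pos.ne')
  have h1 := Representation.card_inv_mul_sum_char_eq_finrank
    -- Projection onto the invariants is the average over the group, so their dimension is the mean
    -- of the character. The character is constant on conjugacy classes of G, and the bijection `e`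
    -- therefore matches the two sums.
    (show Representation ℂ Γ₁ V from ρ.comp Γ₁.subtype)
  have h2 := Representation.card_inv_mul_sum_char_eq_finrank
    (show Representation ℂ Γ₂ V from ρ.comp Γ₂.subtype)
  have hs : ∑ γ : Γ₁, Representation.character
        (show Representation ℂ Γ₁ V from ρ.comp Γ₁.subtype) γ =
      ∑ γ : Γ₂, Representation.character
        (show Representation ℂ Γ₂ V from ρ.comp Γ₂.subtype) γ := by
    refine Fintype.sum_equiv e _ _ fun γ => ?_
    obtain ⟨c, hc⟩ := isConj_iff.1 (he γ)
    change Representation.character ρ (γ : G) = Representation.character ρ (e γ : G)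
    rw [← hc, Representation.char_conj]
  rw [hs, Nat.card_congr e, h2] at h1
  exact_mod_cast h1.symm

/-- A linear map from the invariants of `ρ` under one subgroup to those under an almost conjugate
one, in finite dimension. -/
theorem AlmostConjugate.exists_linearMap_of_finite {Γ₁ Γ₂ : Subgroup G}
    (h : AlmostConjugate Γ₁ Γ₂) {V : Type*} [AddCommGroup V] [Module ℂ V] [FiniteDimensional ℂ V]
    (ρ : Representation ℂ G V) :
    ∃ φ : V →ₗ[ℂ] V, ∀ v, (∀ γ ∈ Γ₁, ρ γ v = v) →
      (∀ γ ∈ Γ₂, ρ γ (φ v) = φ v) ∧ (φ v = 0 → v = 0) := by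
  let I₁ : Submodule ℂ V := Representation.invariants (ρ.comp Γ₁.subtype)
  let I₂ : Submodule ℂ V := Representation.invariants (ρ.comp Γ₂.subtype)
  have e : I₁ ≃ₗ[ℂ] I₂ := LinearEquiv.ofFinrankEq _ _ (h.finrank_invariants ρ)
  -- The values of `φ` off the invariants are arbitrary. A map defined on all of `V` is easier to
  -- assemble over a direct sum than one between subspaces.
  obtain ⟨φ, hφ⟩ := (I₂.subtype.comp e.toLinearMap).exists_extend
  refine ⟨φ, fun v hv => ?_⟩
  have hv' : v ∈ I₁ := fun γ => hv γ γ.2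
  have key : φ v = e ⟨v, hv'⟩ := LinearMap.congr_fun hφ ⟨v, hv'⟩
  rw [key]
  refine ⟨fun γ hγ => (e ⟨v, hv'⟩).2 ⟨γ, hγ⟩, fun h0 => ?_⟩
  have h1 : e ⟨v, hv'⟩ = 0 := Subtype.ext h0
  simpa using h1

/-- The representation of `G` underlying a module over its group algebra. -/
def moduleRep (V : Type*) [AddCommGroup V] [Module ℂ V] [Module (MonoidAlgebra ℂ G) V]
    [IsScalarTower ℂ (MonoidAlgebra ℂ G) V] : Representation ℂ G V :=
  ((Algebra.lsmul ℂ ℂ V : MonoidAlgebra ℂ G →ₐ[ℂ] Module.End ℂ V) :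
    MonoidAlgebra ℂ G →* Module.End ℂ V).comp (MonoidAlgebra.of ℂ G)

/-- By Maschke the module is a direct sum of simple ones. A simple module is finitely generated over
ℂ[G], hence finite dimensional over ℂ, and the finite dimensional maps can be applied summand by
summand. -/
theorem AlmostConjugate.exists_linearMap_of_module {Γ₁ Γ₂ : Subgroup G}
    (h : AlmostConjugate Γ₁ Γ₂) (V : Type*) [AddCommGroup V] [Module ℂ V]
    [Module (MonoidAlgebra ℂ G) V] [IsScalarTower ℂ (MonoidAlgebra ℂ G) V] :
    ∃ φ : V →ₗ[ℂ] V, ∀ v, (∀ γ ∈ Γ₁, MonoidAlgebra.of ℂ G γ • v = v) →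
      (∀ γ ∈ Γ₂, MonoidAlgebra.of ℂ G γ • φ v = φ v) ∧ (φ v = 0 → v = 0) := by
  classical
  have : NeZero (Nat.card G : ℂ) := ⟨Nat.cast_ne_zero.2 Nat.card_pos.ne'⟩
  obtain ⟨s, E, -, hs⟩ := IsSemisimpleModule.exists_linearEquiv_dfinsupp (MonoidAlgebra ℂ G) V
  have hfin : ∀ m : s, FiniteDimensional ℂ m.1 := by
    intro m
    have := hs m
    have : Module.Finite (MonoidAlgebra ℂ G) m.1 := inferInstance
    have : Module.Finite ℂ (MonoidAlgebra ℂ G) := inferInstance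
    exact Module.Finite.trans (MonoidAlgebra ℂ G) m.1
  have hm : ∀ m : s, ∃ φ : m.1 →ₗ[ℂ] m.1, ∀ v, (∀ γ ∈ Γ₁, MonoidAlgebra.of ℂ G γ • v = v) →
      (∀ γ ∈ Γ₂, MonoidAlgebra.of ℂ G γ • φ v = φ v) ∧ (φ v = 0 → v = 0) := fun m => by
    have := hfin m
    exact h.exists_linearMap_of_finite (moduleRep m.1)
  choose φ hφ using hm
  let E' := E.restrictScalars ℂ
  refine ⟨E'.symm.toLinearMap ∘ₗ DFinsupp.mapRange.linearMap φ ∘ₗ E'.toLinearMap,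
    fun v hv => ?_⟩
  -- The maps `φ m` are only ℂ-linear, but `E` is ℂ[G]-linear, so invariance of a vector is
  -- invariance of each of its components.
  have hc : ∀ m, ∀ γ ∈ Γ₁, MonoidAlgebra.of ℂ G γ • (E v) m = (E v) m := by
    intro m γ hγ
    rw [← DFinsupp.smul_apply, ← map_smul, hv γ hγ]
  refine ⟨fun γ hγ => ?_, fun h0 => ?_⟩
  · apply E.injective
    rw [map_smul]
    have : E ((E'.symm.toLinearMap ∘ₗ DFinsupp.mapRange.linearMap φ ∘ₗ E'.toLinearMap) v) =
      DFinsupp.mapRange.linearMap φ (E v) := E.apply_symm_apply _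
    rw [this]
    ext1 m
    rw [DFinsupp.smul_apply]
    exact (hφ m _ (hc m)).1 γ hγ
  · have h1 : DFinsupp.mapRange.linearMap φ (E v) = 0 := by
      apply E'.symm.injective
      rw [map_zero]
      exact h0
    apply E.injective
    rw [map_zero]
    ext1 m
    exact (hφ m _ (hc m)).2 (by simpa using! DFunLike.congr_fun h1 m)

theorem AlmostConjugate.rank_invariants_le {Γ₁ Γ₂ : Subgroup G}
    (h : AlmostConjugate Γ₁ Γ₂) {V : Type*} [AddCommGroup V] [Module ℂ V]
    (ρ : Representation ℂ G V) :
    Module.rank ℂ (Representation.invariants (ρ.comp Γ₁.subtype)) ≤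
      Module.rank ℂ (Representation.invariants (ρ.comp Γ₂.subtype)) := by
  obtain ⟨φ, hφ⟩ := h.exists_linearMap_of_module ρ.asModule
  have hsm : ∀ (γ : G) (v : ρ.asModule), MonoidAlgebra.of ℂ G γ • v = ρ γ v := fun γ v =>
    (Representation.single_smul ρ 1 γ v).trans (one_smul ℂ _)
  simp only [hsm] at hφ
  let φ' : V →ₗ[ℂ] V := φ
  let ψ : Representation.invariants (ρ.comp Γ₁.subtype) →ₗ[ℂ]
      Representation.invariants (ρ.comp Γ₂.subtype) :=
    (φ' ∘ₗ Submodule.subtype _).codRestrict _ fun v γ =>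
      (hφ v.1 fun γ hγ => v.2 ⟨γ, hγ⟩).1 γ γ.2
  refine LinearMap.rank_le_of_injective ψ ((injective_iff_map_eq_zero ψ).2 fun v hv => ?_)
  exact Subtype.ext ((hφ v.1 fun γ hγ => v.2 ⟨γ, hγ⟩).2 (congrArg Subtype.val hv))

/-- The spaces of invariants of almost conjugate subgroups have the same dimension, in every
representation of `G` over `ℂ`. -/
theorem AlmostConjugate.rank_invariants_eq {Γ₁ Γ₂ : Subgroup G}
    (h : AlmostConjugate Γ₁ Γ₂) {V : Type*} [AddCommGroup V] [Module ℂ V]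
    (ρ : Representation ℂ G V) :
    Module.rank ℂ (Representation.invariants (ρ.comp Γ₁.subtype)) =
      Module.rank ℂ (Representation.invariants (ρ.comp Γ₂.subtype)) :=
  le_antisymm (h.rank_invariants_le ρ) (h.symm.rank_invariants_le ρ)

end Representation

/-! ## Tensor powers and frames -/

section Fiber

variable {N : Type*} {V : N → Type*} [∀ y, AddCommGroup (V y)] [∀ y, Module ℂ (V y)]

theorem framePow_smul (k : ℕ) (u : N → ℂ) (e : Π y, V y) (y : N) :
    framePow k (fun z => u z • e z) y = u y ^ k • framePow k e y := by
  simpa [framePow] using MultilinearMap.map_smul_univ (PiTensorProduct.tprod ℂ)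
    (fun _ : Fin k => u y) (fun _ => e y)

theorem framePow_congr {k : ℕ} {e e' : Π y, V y} {y : N} (h : e y = e' y) :
    framePow k e y = framePow k e' y := by
  simp [framePow, h]

/-- A complex vector space which is a line. -/
def IsLine (W : Type*) [AddCommGroup W] [Module ℂ W] : Prop :=
  Nonempty (W ≃ₗ[ℂ] ℂ)

theorem IsLine.exists_smul_eq {W : Type*} [AddCommGroup W] [Module ℂ W] (hW : IsLine W) {e : W}
    (he : e ≠ 0) (v : W) : ∃ c : ℂ, v = c • e := by
  obtain ⟨φ⟩ := hW
  refine ⟨φ v / φ e, φ.injective ?_⟩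
  rw [map_smul, smul_eq_mul, div_mul_cancel₀]
  simpa using he

/-- The trivialization of the tensor power of a trivialized line. -/
def tensorTriv (k : ℕ) {W : Type*} [AddCommGroup W] [Module ℂ W] (φ : W ≃ₗ[ℂ] ℂ) :
    (⨂[ℂ] _i : Fin k, W) ≃ₗ[ℂ] ℂ :=
  (PiTensorProduct.congr fun _ : Fin k => φ).trans
    (PiTensorProduct.constantBaseRingEquiv (Fin k) ℂ).toLinearEquiv

theorem tensorTriv_tprod (k : ℕ) {W : Type*} [AddCommGroup W] [Module ℂ W] (φ : W ≃ₗ[ℂ] ℂ) (e : W) :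
    tensorTriv k φ (PiTensorProduct.tprod ℂ fun _ => e) = φ e ^ k := by
  simp [tensorTriv, PiTensorProduct.constantBaseRingEquiv_tprod]

/-- A trivialization φ of the line sends e ⊗ ⋯ ⊗ e to φ(e)^k, which is nonzero, also for `k = 0`. -/
theorem IsLine.framePow_ne_zero {y : N} (hV : IsLine (V y)) {e : Π y, V y} (he : e y ≠ 0) (k : ℕ) :
    framePow k e y ≠ 0 := by
  obtain ⟨φ⟩ := hV
  intro h
  have := congrArg (tensorTriv k φ) h
  rw [framePow, tensorTriv_tprod, map_zero] at this
  exact he ((map_eq_zero_iff φ φ.injective).1 (by by_contra h0; exact pow_ne_zero k h0 this))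

theorem IsLine.tensor {W : Type*} [AddCommGroup W] [Module ℂ W] (hW : IsLine W) (k : ℕ) :
    IsLine (⨂[ℂ] _i : Fin k, W) := by
  obtain ⟨φ⟩ := hW
  exact ⟨tensorTriv k φ⟩

theorem frameCoord_smul_framePow {k : ℕ} {e : Π y, V y} {t : Π y, TensorFiber V k y} {y : N}
    (hV : IsLine (V y)) (he : e y ≠ 0) : frameCoord k e t y • framePow k e y = t y := by
  have h : ∃ c : ℂ, t y = c • framePow k e y :=
    (hV.tensor k).exists_smul_eq (hV.framePow_ne_zero he k) (t y)
  rw [frameCoord, dif_pos h, ← h.choose_spec]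

theorem frameCoord_eq {k : ℕ} {e : Π y, V y} {t : Π y, TensorFiber V k y} {y : N}
    (hV : IsLine (V y)) (he : e y ≠ 0) {c : ℂ} (h : t y = c • framePow k e y) :
    frameCoord k e t y = c :=
  smul_left_injective ℂ (hV.framePow_ne_zero he k)
    ((frameCoord_smul_framePow hV he).trans h)

open Classical in
/-- The chosen element satisfying the predicate `p`, or `0` if there is none. -/
def chooseOrZero (p : ℂ → Prop) : ℂ := if h : ∃ c, p c then h.choose else 0

/-- The coordinate depends only on a predicate on ℂ. Equal predicates thus give equal coordinates,
even for sections of different bundles and at points where no coordinate exists and the default 0 is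
taken. -/
theorem frameCoord_eq_chooseOrZero (k : ℕ) (e : Π y, V y) (t : Π y, TensorFiber V k y) (y : N) :
    frameCoord k e t y = chooseOrZero fun c => t y = c • framePow k e y := rfl

theorem frameCoord_congr {k : ℕ} {e e' : Π y, V y} {t t' : Π y, TensorFiber V k y} {y : N}
    (he : e y = e' y) (ht : t y = t' y) : frameCoord k e t y = frameCoord k e' t' y := by
  have : (fun c : ℂ => t y = c • framePow k e y) = fun c : ℂ => t' y = c • framePow k e' y := by
    rw [ht, framePow_congr he]
  rw [frameCoord_eq_chooseOrZero, this, frameCoord_eq_chooseOrZero]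

theorem frameCoord_add {k : ℕ} {e : Π y, V y} {t t' : Π y, TensorFiber V k y} {y : N}
    (hV : IsLine (V y)) (he : e y ≠ 0) :
    frameCoord k e (t + t') y = frameCoord k e t y + frameCoord k e t' y := by
  refine frameCoord_eq hV he ?_
  rw [add_smul, frameCoord_smul_framePow hV he, frameCoord_smul_framePow hV he]
  rfl

theorem frameCoord_const_smul {k : ℕ} {e : Π y, V y} {t : Π y, TensorFiber V k y} {y : N} (c : ℂ)
    (hV : IsLine (V y)) (he : e y ≠ 0) :
    frameCoord k e (c • t) y = c * frameCoord k e t y := by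
  refine frameCoord_eq hV he ?_
  rw [mul_smul, frameCoord_smul_framePow hV he]
  rfl

/-- Since e' = ue, the k-th power of e' is u^k times that of e, and the coordinate changes by the
inverse factor. -/
theorem frameCoord_change {k : ℕ} {u : N → ℂ} {e e' : Π y, V y} {t : Π y, TensorFiber V k y} {y : N}
    (hV : IsLine (V y)) (he' : e' y ≠ 0) (he : e' y = u y • e y) :
    frameCoord k e t y = frameCoord k e' t y * u y ^ k := by
  have he0 : e y ≠ 0 := by
    rintro h
    rw [h, smul_zero] at he
    exact he' he
  refine frameCoord_eq hV he0 ?_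
  rw [mul_smul, ← framePow_smul k u e y, ← framePow_congr (e := e') he,
    frameCoord_smul_framePow hV he']

theorem sum_tprod_update {y : N} (k : ℕ) (e : Π y, V y) (v : V y) {c : ℂ} (h : v = c • e y) :
    ∑ j : Fin k, PiTensorProduct.tprod ℂ (Function.update (fun _ : Fin k => e y) j v)
      = (k * c) • framePow k e y := by
  subst h
  have : ∀ j : Fin k, PiTensorProduct.tprod ℂ (Function.update (fun _ : Fin k => e y) j (c • e y)) =
      c • framePow k e y := by
    intro j
    rw [MultilinearMap.map_update_smul, Function.update_eq_self]
    rfl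
  simp [this, mul_smul, Nat.cast_smul_eq_nsmul]

end Fiber

/-! ### The induced connection in a given frame -/

section Conn

variable {n : ℕ} {N : Type*} [TopologicalSpace N] [ChartedSpace (EuclideanSpace ℝ (Fin n)) N]
  {V : N → Type*} [∀ y, AddCommGroup (V y)] [∀ y, Module ℂ (V y)]

/-- The derivative of a complex valued function on `N`. -/
def cderiv (f : N → ℂ) (y : N) : EuclideanSpace ℝ (Fin n) →L[ℝ] ℂ :=
  mfderiv (𝓡 n) 𝓘(ℝ, ℂ) f y

theorem cderiv_congr {f f' : N → ℂ} {y : N} (h : f =ᶠ[nhds y] f') :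
    (cderiv f y : EuclideanSpace ℝ (Fin n) →L[ℝ] ℂ) = cderiv f' y :=
  h.mfderiv_eq

/-- The Leibniz rule for the covariant derivative of a section of the tensor power, with respect to
a given frame. -/
def tensorConnWith (D : Conn n V) (k : ℕ) (e : Π y, V y) (t : Π y, TensorFiber V k y) (y : N)
    (w : EuclideanSpace ℝ (Fin n)) : TensorFiber V k y :=
  cderiv (frameCoord k e t) y w • framePow k e y
    + frameCoord k e t y •
      ∑ j : Fin k, PiTensorProduct.tprod ℂ (Function.update (fun _ : Fin k => e y) j (D e y w))

theorem tensorConn_eq [TopologicalSpace (TotalSpace ℂ V)]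
    [ChartedSpace (ModelProd (EuclideanSpace ℝ (Fin n)) ℂ) (TotalSpace ℂ V)] (D : Conn n V)
    (k : ℕ) (t : Π y, TensorFiber V k y) (y : N) (w : EuclideanSpace ℝ (Fin n)) :
    tensorConn D k t y w = tensorConnWith D k (chosenFrame n V y) t y w := rfl

theorem tensorConnWith_congr (D : Conn n V) (k : ℕ) (e : Π y, V y) {t t' : Π y, TensorFiber V k y}
    {y : N} (h : ∀ᶠ z in nhds y, t z = t' z) (w : EuclideanSpace ℝ (Fin n)) :
    tensorConnWith D k e t y w = tensorConnWith D k e t' y w := by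
  have h1 : frameCoord k e t =ᶠ[nhds y] frameCoord k e t' :=
    h.mono fun z hz => frameCoord_congr rfl hz
  rw [tensorConnWith, tensorConnWith, cderiv_congr h1, h1.self_of_nhds]

/-- Each of the k Leibniz terms contributes c, so c becomes kc on the k-th tensor power: the
covariant derivative of f·e^k is (df + kcf)·e^k. -/
theorem tensorConnWith_eq (D : Conn n V) (k : ℕ) (e : Π y, V y) (t : Π y, TensorFiber V k y) {y : N}
    {w : EuclideanSpace ℝ (Fin n)} {c : ℂ} (h : D e y w = c • e y) :
    tensorConnWith D k e t y w =
      (cderiv (frameCoord k e t) y w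
        + k * c * frameCoord k e t y) • framePow k e y := by
  rw [tensorConnWith, sum_tprod_update k e _ h, smul_smul, add_smul]
  congr 2
  ring

end Conn

/-! ## Smooth sections of a line bundle -/

section LineBundle

variable {n : ℕ} {M : Type*} [TopologicalSpace M]
  [ChartedSpace (EuclideanSpace ℝ (Fin n)) M]
  {L : M → Type*} [TopologicalSpace (TotalSpace ℂ L)]
  [∀ x, AddCommGroup (L x)] [∀ x, Module ℂ (L x)] [∀ x, TopologicalSpace (L x)]
  [FiberBundle ℂ L] [VectorBundle ℂ ℂ L]

theorem isLine_fiber (x : M) : IsLine (L x) :=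
  ⟨(trivializationAt ℂ L x).linearEquivAt ℂ x (FiberBundle.mem_baseSet_trivializationAt' x)⟩

/-- The coordinate of a vector in `L z` in the trivialization of `L` at `x`. -/
def trivCoord (x z : M) : L z →ₗ[ℂ] ℂ := (trivializationAt ℂ L x).linearMapAt ℂ z

theorem eventually_mem_baseSet (x : M) : ∀ᶠ z in nhds x, z ∈ (trivializationAt ℂ L x).baseSet :=
  (trivializationAt ℂ L x).open_baseSet.mem_nhds (FiberBundle.mem_baseSet_trivializationAt' x)

theorem trivCoord_apply {x z : M} (hz : z ∈ (trivializationAt ℂ L x).baseSet) (v : L z) :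
    trivCoord x z v = (trivializationAt ℂ L x ⟨z, v⟩).2 := by
  rw [trivCoord, Trivialization.coe_linearMapAt_of_mem _ hz]

theorem trivCoord_ne_zero {x z : M} (hz : z ∈ (trivializationAt ℂ L x).baseSet) {v : L z}
    (hv : v ≠ 0) : trivCoord x z v ≠ 0 := by
  intro h
  apply hv
  have := (trivializationAt ℂ L x).symm_linearMapAt (R := ℂ) hz v
  rw [← this, show (trivializationAt ℂ L x).linearMapAt ℂ z v = 0 from h]
  exact map_zero ((trivializationAt ℂ L x).linearEquivAt ℂ z hz).symm

theorem contMDiffAt_mul_complex {u v : M → ℂ} {x : M} (hu : ContMDiffAt (𝓡 n) 𝓘(ℝ, ℂ) ∞ u x)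
    (hv : ContMDiffAt (𝓡 n) 𝓘(ℝ, ℂ) ∞ v x) :
    ContMDiffAt (𝓡 n) 𝓘(ℝ, ℂ) ∞ (fun z => u z * v z) x :=
  ContMDiffAt.comp (I' := 𝓘(ℝ, ℂ × ℂ)) x (g := fun p : ℂ × ℂ => p.1 * p.2)
    (contDiff_mul.contDiffAt.contMDiffAt) (hu.prodMk_space hv)

/-- This reduces smoothness of sections to smoothness of complex functions; only the trivialization
centered at `x` is used. -/
theorem smoothSectionAt_iff {s : Π x, L x} {x : M} :
    SmoothSectionAt n s x ↔
      ContMDiffAt (𝓡 n) 𝓘(ℝ, ℂ) ∞ (fun z => trivCoord x z (s z)) x := by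
  rw [SmoothSectionAt, contMDiffAt_section]
  refine Filter.EventuallyEq.contMDiffAt_iff ?_
  filter_upwards [eventually_mem_baseSet (L := L) x] with z hz
  exact (trivCoord_apply hz _).symm

theorem SmoothSectionAt.congr {s s' : Π x, L x} {x : M} (hs : SmoothSectionAt n s x)
    (h : ∀ᶠ z in nhds x, s z = s' z) : SmoothSectionAt n s' x :=
  ContMDiffAt.congr_of_eventuallyEq hs (h.mono fun z hz => by simp only [hz])

theorem SmoothSectionAt.smul {s : Π x, L x} {u : M → ℂ} {x : M} (hs : SmoothSectionAt n s x)
    (hu : ContMDiffAt (𝓡 n) 𝓘(ℝ, ℂ) ∞ u x) : SmoothSectionAt n (fun z => u z • s z) x := by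
  rw [smoothSectionAt_iff] at *
  simpa only [map_smul] using! contMDiffAt_mul_complex hu hs

theorem IsFrameAt.smooth {e : Π x, L x} {x : M} (he : IsFrameAt n e x) : SmoothSectionAt n e x :=
  he.1.self_of_nhds

theorem SmoothSectionAt.eventually_ne_zero {e : Π x, L x} {x : M} (he : SmoothSectionAt n e x)
    (h0 : e x ≠ 0) : ∀ᶠ z in nhds x, e z ≠ 0 := by
  have h1 := (smoothSectionAt_iff.1 he).continuousAt
  have h2 : trivCoord x x (e x) ≠ 0 :=
    trivCoord_ne_zero (FiberBundle.mem_baseSet_trivializationAt' x) h0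
  filter_upwards [h1.eventually_ne h2] with z hz h
  rw [h, map_zero] at hz
  exact hz rfl

theorem IsFrameAt.eventually_ne_zero {e : Π x, L x} {x : M} (he : IsFrameAt n e x) :
    ∀ᶠ z in nhds x, e z ≠ 0 :=
  he.smooth.eventually_ne_zero he.2

theorem IsFrameAt.eventually {e : Π x, L x} {x : M} (he : IsFrameAt n e x) :
    ∀ᶠ z in nhds x, IsFrameAt n e z :=
  he.1.eventually_nhds.and he.eventually_ne_zero

open Classical in
/-- The quotient `s / e` of two sections of a line bundle. -/
def sectionRatio (s e : Π x, L x) (z : M) : ℂ :=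
  if h : ∃ c : ℂ, s z = c • e z then h.choose else 0

theorem sectionRatio_smul {s e : Π x, L x} {z : M} (he : e z ≠ 0) :
    sectionRatio s e z • e z = s z := by
  have h : ∃ c : ℂ, s z = c • e z := (isLine_fiber z).exists_smul_eq he (s z)
  rw [sectionRatio, dif_pos h]
  exact h.choose_spec.symm

/-- Near `x` the ratio is the quotient of the two coordinates in a trivialization. -/
theorem SmoothSectionAt.sectionRatio {s e : Π x, L x} {x : M} (hs : SmoothSectionAt n s x)
    (he : SmoothSectionAt n e x) (h0 : e x ≠ 0) :
    ContMDiffAt (𝓡 n) 𝓘(ℝ, ℂ) ∞ (sectionRatio s e) x := by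
  have h1 := smoothSectionAt_iff.1 hs
  have h2 := smoothSectionAt_iff.1 he
  have h3 : trivCoord x x (e x) ≠ 0 :=
    trivCoord_ne_zero (FiberBundle.mem_baseSet_trivializationAt' x) h0
  have h4 : ContMDiffAt (𝓡 n) 𝓘(ℝ, ℂ) ∞
      (fun z => trivCoord x z (s z) / trivCoord x z (e z)) x := by
    have : ContMDiffAt 𝓘(ℝ, ℂ) 𝓘(ℝ, ℂ) ∞ (fun c : ℂ => c⁻¹) (trivCoord x x (e x)) :=
      (contDiffAt_inv ℝ h3).contMDiffAt
    simpa only [div_eq_mul_inv] using! contMDiffAt_mul_complex h1 (this.comp x h2)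
  refine h4.congr_of_eventuallyEq ?_
  filter_upwards [eventually_mem_baseSet (L := L) x, he.eventually_ne_zero h0] with z hz hz0
  rw [eq_div_iff (trivCoord_ne_zero hz hz0), ← smul_eq_mul, ← map_smul, sectionRatio_smul hz0]

/-- The constant section 1 of a local trivialization is a frame. -/
theorem exists_isFrameAt [VectorBundle ℝ ℂ L] [ContMDiffVectorBundle ∞ ℂ L (𝓡 n)] (x : M) :
    ∃ e : Π x, L x, IsFrameAt n e x := by
  let τ := trivializationAt ℂ L x
  have hx : x ∈ τ.baseSet := FiberBundle.mem_baseSet_trivializationAt' x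
  refine ⟨fun z => τ.symm z 1, ?_, ?_⟩
  · filter_upwards [eventually_mem_baseSet (L := L) x] with z hz
    refine (τ.contMDiffAt_section_iff hz).2 ?_
    have : ContMDiffAt (𝓡 n) 𝓘(ℝ, ℂ) ∞ (fun _ : M => (1 : ℂ)) z := contMDiffAt_const
    refine this.congr_of_eventuallyEq ?_
    filter_upwards [τ.open_baseSet.mem_nhds hz] with y hy
    rw [τ.apply_mk_symm hy]
  · intro h
    have h1 := τ.apply_mk_symm hx (1 : ℂ)
    rw [show τ.symm x 1 = 0 from h] at h1
    have h2 := congrArg Prod.snd h1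
    rw [← trivCoord_apply hx, map_zero] at h2
    exact zero_ne_one h2

variable (n L) in
theorem isFrameAt_chosenFrame [VectorBundle ℝ ℂ L] [ContMDiffVectorBundle ∞ ℂ L (𝓡 n)] (x : M) :
    IsFrameAt n (chosenFrame n L x) x := by
  rw [chosenFrame, dif_pos (exists_isFrameAt x)]
  exact (exists_isFrameAt (n := n) (L := L) x).choose_spec

/-- A section which is smooth near `x` agrees near `x` with a smooth section. -/
theorem exists_contMDiff_section [T2Space M] [IsManifold (𝓡 n) ∞ M] [VectorBundle ℝ ℂ L]
    [ContMDiffVectorBundle ∞ ℂ L (𝓡 n)] {s : Π x, L x} {x : M}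
    (hs : ∀ᶠ z in nhds x, SmoothSectionAt n s z) :
    ∃ s' : Π x, L x, ContMDiff (𝓡 n) ((𝓡 n).prod 𝓘(ℝ, ℂ)) ∞ (fun z => TotalSpace.mk' ℂ z (s' z)) ∧
      ∀ᶠ z in nhds x, s z = s' z := by
  obtain ⟨U, hUs, hU, hxU⟩ := eventually_nhds_iff.1 hs
  obtain ⟨b, hb, -⟩ := (SmoothBumpFunction.nhds_basis_support (I := 𝓡 n) (c := x)
    (hU.mem_nhds hxU)).mem_iff.1 (hU.mem_nhds hxU)
  refine ⟨(b : M → ℝ) • s, ?_, ?_⟩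
  · refine ContMDiffOn.smul_section_of_tsupport (u := U) b.contMDiff.contMDiffOn hU hb ?_
    exact fun z hz => (hUs z hz).contMDiffWithinAt
  · filter_upwards [b.eventuallyEq_one] with z hz
    simp [hz]

end LineBundle

/-! ### Derivatives of functions and coordinate vector fields -/

section Charts

variable {n : ℕ} {M : Type*} [TopologicalSpace M] [ChartedSpace (EuclideanSpace ℝ (Fin n)) M]

theorem hasMFDerivAt_cderiv {f : M → ℂ} {x : M} (hf : MDifferentiableAt (𝓡 n) 𝓘(ℝ, ℂ) f x) :
    HasMFDerivAt (𝓡 n) 𝓘(ℝ, ℂ) f x (cderiv f x) :=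
  hf.hasMFDerivAt

theorem cderiv_add {u v : M → ℂ} {x : M} (hu : MDifferentiableAt (𝓡 n) 𝓘(ℝ, ℂ) u x)
    (hv : MDifferentiableAt (𝓡 n) 𝓘(ℝ, ℂ) v x) (w : EuclideanSpace ℝ (Fin n)) :
    cderiv (fun z => u z + v z) x w = cderiv u x w + cderiv v x w :=
  DFunLike.congr_fun (((hasMFDerivAt_cderiv hu).add (hasMFDerivAt_cderiv hv)).mfderiv) w

theorem cderiv_mul {u v : M → ℂ} {x : M} (hu : MDifferentiableAt (𝓡 n) 𝓘(ℝ, ℂ) u x)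
    (hv : MDifferentiableAt (𝓡 n) 𝓘(ℝ, ℂ) v x) (w : EuclideanSpace ℝ (Fin n)) :
    cderiv (fun z => u z * v z) x w = u x * cderiv v x w + v x * cderiv u x w :=
  DFunLike.congr_fun (((hasMFDerivAt_cderiv hu).mul (hasMFDerivAt_cderiv hv)).mfderiv) w

theorem cderiv_const_mul (c : ℂ) {u : M → ℂ} {x : M} (hu : MDifferentiableAt (𝓡 n) 𝓘(ℝ, ℂ) u x)
    (w : EuclideanSpace ℝ (Fin n)) :
    cderiv (fun z => c * u z) x w = c * cderiv u x w := by
  rw [cderiv_mul mdifferentiableAt_const hu]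
  have : (cderiv (fun _ : M => c) x : EuclideanSpace ℝ (Fin n) →L[ℝ] ℂ) = 0 := mfderiv_const
  simp [this]

/-- The factor `u x` on the left avoids the exponent k − 1, so that `k = 0` needs no separate
statement. -/
theorem cderiv_pow {u : M → ℂ} {x : M} (hu : MDifferentiableAt (𝓡 n) 𝓘(ℝ, ℂ) u x) (k : ℕ)
    (w : EuclideanSpace ℝ (Fin n)) :
    u x * cderiv (fun z => u z ^ k) x w = k * u x ^ k * cderiv u x w := by
  induction k with
  | zero =>
    have : (cderiv (fun _ : M => (1 : ℂ)) x : EuclideanSpace ℝ (Fin n) →L[ℝ] ℂ) = 0 := mfderiv_const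
    simp [this]
  | succ k ih =>
    have h1 : MDifferentiableAt (𝓡 n) 𝓘(ℝ, ℂ) (fun z => u z ^ k) x := hu.pow k
    simp only [pow_succ]
    rw [cderiv_mul h1 hu]
    push_cast
    linear_combination u x * ih

variable [IsManifold (𝓡 n) ∞ M] {φ : OpenPartialHomeomorph M (EuclideanSpace ℝ (Fin n))}

theorem mdifferentiable_of_mem_maximalAtlas (hφ : φ ∈ IsManifold.maximalAtlas (𝓡 n) ∞ M) :
    φ.MDifferentiable (𝓡 n) (𝓡 n) :=
  ⟨(contMDiffOn_of_mem_maximalAtlas hφ).mdifferentiableOn (by simp),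
    (contMDiffOn_symm_of_mem_maximalAtlas hφ).mdifferentiableOn (by simp)⟩

theorem coordField_eq (hφ : φ ∈ IsManifold.maximalAtlas (𝓡 n) ∞ M) (i : Fin n) {x : M}
    (hx : x ∈ φ.source) :
    coordField φ i x = (mfderiv (𝓡 n) (𝓡 n) φ.symm (φ x) (EuclideanSpace.single i (1 : ℝ)) :
      EuclideanSpace ℝ (Fin n)) := by
  have h := mdifferentiable_of_mem_maximalAtlas hφ
  have h1 : ((h.mfderiv hx : TangentSpace (𝓡 n) x ≃L[ℝ] TangentSpace (𝓡 n) (φ x)) :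
      TangentSpace (𝓡 n) x →L[ℝ] TangentSpace (𝓡 n) (φ x)) = mfderiv (𝓡 n) (𝓡 n) φ x := rfl
  rw [coordField, ← h1, ContinuousLinearMap.inverse_equiv]
  rfl

/-- The field is the tangent map of `φ.symm` applied to a constant vector field, composed with `φ`.
-/
theorem contMDiffAt_coordField (hφ : φ ∈ IsManifold.maximalAtlas (𝓡 n) ∞ M) (i : Fin n) {x : M}
    (hx : x ∈ φ.source) :
    ContMDiffAt (𝓡 n) ((𝓡 n).prod (𝓡 n)) ∞
      (fun z => TotalSpace.mk' (EuclideanSpace ℝ (Fin n)) z (coordField φ i z)) x := by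
  let s : EuclideanSpace ℝ (Fin n) → TangentBundle (𝓡 n) (EuclideanSpace ℝ (Fin n)) :=
    fun y => ⟨y, EuclideanSpace.single i (1 : ℝ)⟩
  have hs : ContMDiff (𝓡 n) ((𝓡 n).prod (𝓡 n)) ∞ s :=
    contMDiff_vectorSpace_iff_contDiff.2 contDiff_const
  have h1 := (contMDiffOn_symm_of_mem_maximalAtlas hφ).contMDiffOn_tangentMapWithin
    (m := ∞) (by simp) φ.open_target.uniqueMDiffOn
  have hy : φ x ∈ φ.target := φ.map_source hx
  have h2 : ContMDiffAt ((𝓡 n).prod (𝓡 n)) ((𝓡 n).prod (𝓡 n)) ∞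
      (tangentMapWithin (𝓡 n) (𝓡 n) φ.symm φ.target) (s (φ x)) :=
    (h1 (s (φ x)) hy).contMDiffAt
      ((φ.open_target.preimage (FiberBundle.continuous_proj _ _)).mem_nhds hy)
  have h3 := h2.comp x ((hs (φ x)).comp x (contMDiffAt_of_mem_maximalAtlas hφ hx))
  refine h3.congr_of_eventuallyEq ?_
  filter_upwards [φ.open_source.mem_nhds hx] with z hz
  have hz' : φ z ∈ φ.target := φ.map_source hz
  rw [coordField_eq hφ i hz]
  simp only [Function.comp_apply, tangentMapWithin, s,
    mfderivWithin_of_isOpen φ.open_target hz']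
  -- The base point `φ.symm (φ z)` equals `z` only propositionally, while the vector lives in the
  -- common model space of all tangent spaces.
  have aux : ∀ z' : M, z' = z → ∀ v : EuclideanSpace ℝ (Fin n),
      (TotalSpace.mk' (EuclideanSpace ℝ (Fin n)) z v : TangentBundle (𝓡 n) M) =
        TotalSpace.mk' (EuclideanSpace ℝ (Fin n)) z' v := by
    rintro _ rfl _
    rfl
  exact aux _ (φ.left_inv hz) _

end Charts

/-! ### Complex Leibniz rule, locality and smoothness of the connection -/

section Connection

variable {n : ℕ} {M : Type*} [TopologicalSpace M] [T2Space M]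
  [ChartedSpace (EuclideanSpace ℝ (Fin n)) M] [IsManifold (𝓡 n) ∞ M]
  {L : M → Type*} [TopologicalSpace (TotalSpace ℂ L)]
  [∀ x, AddCommGroup (L x)] [∀ x, Module ℂ (L x)] [∀ x, TopologicalSpace (L x)]
  [∀ x, IsTopologicalAddGroup (L x)] [∀ x, ContinuousSMul ℝ (L x)]
  [FiberBundle ℂ L] [VectorBundle ℂ ℂ L] [VectorBundle ℝ ℂ L]
  [ContMDiffVectorBundle ∞ ℂ L (𝓡 n)] {h : HermitianMetric n L}
  {D : CovariantDerivative (𝓡 n) ℂ L}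

/-- The underlying data of a covariant derivative. -/
def connOf (D : CovariantDerivative (𝓡 n) ℂ L) : Conn n L := fun s y w => D s y w

theorem SmoothSectionAt.mdifferentiableAt {s : Π x, L x} {x : M} (hs : SmoothSectionAt n s x) :
    MDifferentiableAt (𝓡 n) ((𝓡 n).prod 𝓘(ℝ, ℂ)) (fun z => TotalSpace.mk' ℂ z (s z)) x :=
  ContMDiffAt.mdifferentiableAt hs (by simp)

theorem connOf_congr {s s' : Π x, L x} {x : M} (hs : SmoothSectionAt n s x)
    (hss' : ∀ᶠ z in nhds x, s z = s' z) (w : EuclideanSpace ℝ (Fin n)) :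
    connOf D s x w = connOf D s' x w := by
  have := D.isCovariantDerivativeOnUniv.congr_of_eventuallyEq hs.mdifferentiableAt
    (hs.congr hss').mdifferentiableAt Filter.univ_mem hss'
  exact DFunLike.congr_fun this w

theorem connOf_real_smul {s : Π x, L x} {u : M → ℝ} {x : M} (hs : SmoothSectionAt n s x)
    (hu : MDifferentiableAt (𝓡 n) 𝓘(ℝ, ℝ) u x) (w : EuclideanSpace ℝ (Fin n)) :
    connOf D (fun z => u z • s z) x w =
      u x • connOf D s x w + (mvfderiv (𝓡 n) u x w) • s x :=
  DFunLike.congr_fun (D.isCovariantDerivativeOnUniv.leibniz hs.mdifferentiableAt hu) w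

theorem connOf_add {s s' : Π x, L x} {x : M} (hs : SmoothSectionAt n s x)
    (hs' : SmoothSectionAt n s' x) (w : EuclideanSpace ℝ (Fin n)) :
    connOf D (fun z => s z + s' z) x w = connOf D s x w + connOf D s' x w :=
  DFunLike.congr_fun
    (D.isCovariantDerivativeOnUniv.add hs.mdifferentiableAt hs'.mdifferentiableAt) w

/-- A `CovariantDerivative` here obeys the Leibniz rule for real functions. Writing us = (Re u)s +
(Im u)(is), the complex rule follows from the real one and from D(is) = iDs. -/
theorem connOf_smul (hD : IsHermitianConnection h D) {s : Π x, L x} {u : M → ℂ} {x : M}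
    (hs : SmoothSectionAt n s x) (hu : ContMDiffAt (𝓡 n) 𝓘(ℝ, ℂ) ∞ u x)
    (w : EuclideanSpace ℝ (Fin n)) :
    connOf D (fun z => u z • s z) x w = u x • connOf D s x w + cderiv u x w • s x := by
  have hu1 : MDifferentiableAt (𝓡 n) 𝓘(ℝ, ℂ) u x := hu.mdifferentiableAt (by simp)
  have hre : ContMDiffAt (𝓡 n) 𝓘(ℝ, ℝ) ∞ (fun z => (u z).re) x :=
    (Complex.reCLM.contDiff.contDiffAt.contMDiffAt).comp x hu
  have him : ContMDiffAt (𝓡 n) 𝓘(ℝ, ℝ) ∞ (fun z => (u z).im) x :=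
    (Complex.imCLM.contDiff.contDiffAt.contMDiffAt).comp x hu
  have dre : (mvfderiv (𝓡 n) (fun z => (u z).re) x w : ℝ) = (cderiv u x w).re :=
    DFunLike.congr_fun ((Complex.reCLM.hasFDerivAt.hasMFDerivAt.comp x
      (hasMFDerivAt_cderiv hu1)).mfderiv) w
  have dim : (mvfderiv (𝓡 n) (fun z => (u z).im) x w : ℝ) = (cderiv u x w).im :=
    DFunLike.congr_fun ((Complex.imCLM.hasFDerivAt.hasMFDerivAt.comp x
      (hasMFDerivAt_cderiv hu1)).mfderiv) w
  have hI : SmoothSectionAt n (fun z => Complex.I • s z) x := hs.smul contMDiffAt_const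
  have e1 : (fun z => u z • s z) =
      fun z => (u z).re • s z + (u z).im • (Complex.I • s z) := by
    funext z
    conv_lhs => rw [← Complex.re_add_im (u z)]
    rw [add_smul, mul_smul]
    rfl
  have hs1 : SmoothSectionAt n (fun z => (u z).re • s z) x :=
    hs.smul (u := fun z => ((u z).re : ℂ))
      ((Complex.ofRealCLM.contDiff.contDiffAt.contMDiffAt).comp x hre)
  have hs2 : SmoothSectionAt n (fun z => (u z).im • (Complex.I • s z)) x :=
    hI.smul (u := fun z => ((u z).im : ℂ))
      ((Complex.ofRealCLM.contDiff.contDiffAt.contMDiffAt).comp x him)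
  have e2 : connOf D (fun z => Complex.I • s z) x w = Complex.I • connOf D s x w :=
    hD.complexLinear s x w Complex.I hs
  rw [e1, connOf_add hs1 hs2, connOf_real_smul hs (hre.mdifferentiableAt (by simp)),
    connOf_real_smul hI (him.mdifferentiableAt (by simp)), e2, dre, dim]
  conv_rhs => rw [← Complex.re_add_im (u x), ← Complex.re_add_im (cderiv u x w)]
  simp only [add_smul, mul_smul, Complex.coe_smul]
  abel

theorem connOf_smooth (hD : IsHermitianConnection h D) {s : Π x, L x} {x : M}
    (hs : ∀ᶠ z in nhds x, SmoothSectionAt n s z) {X : M → EuclideanSpace ℝ (Fin n)}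
    (hX : ContMDiffAt (𝓡 n) ((𝓡 n).prod (𝓡 n)) ∞
      (fun z => TotalSpace.mk' (E := fun z : M => TangentSpace (𝓡 n) z)
        (EuclideanSpace ℝ (Fin n)) z (X z)) x) :
    SmoothSectionAt n (fun z => connOf D s z (X z)) x := by
  -- Smoothness of `D` is applied to a section smooth on all of `M`; a cutoff provides one, and
  -- locality of `D` carries the result back to `s`.
  obtain ⟨s', hs', hss'⟩ := exists_contMDiff_section hs
  have h1 := hD.smooth.contMDiff.contMDiff (σ := s') hs'.contMDiffOn
  have h2 : SmoothSectionAt n (fun z => connOf D s' z (X z)) x :=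
    ContMDiffAt.clm_bundle_apply (E₁ := fun z : M => TangentSpace (𝓡 n) z) (b := fun z => z)
      (ϕ := fun z => D s' z) (v := X) (contMDiffOn_univ.1 h1 x) hX
  refine h2.congr ?_
  filter_upwards [hss'.eventually_nhds, hs] with z hz hsz
  exact (connOf_congr hsz hz _).symm

end Connection

/-! ### The induced connection and the Laplacian on tensor powers over M -/

section TensorConnection

variable {n : ℕ} {M : Type*} [TopologicalSpace M] [T2Space M]
  [ChartedSpace (EuclideanSpace ℝ (Fin n)) M] [IsManifold (𝓡 n) ∞ M]
  {L : M → Type*} [TopologicalSpace (TotalSpace ℂ L)]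
  [∀ x, AddCommGroup (L x)] [∀ x, Module ℂ (L x)] [∀ x, TopologicalSpace (L x)]
  [∀ x, IsTopologicalAddGroup (L x)] [∀ x, ContinuousSMul ℝ (L x)]
  [FiberBundle ℂ L] [VectorBundle ℂ ℂ L] [VectorBundle ℝ ℂ L]
  [ContMDiffVectorBundle ∞ ℂ L (𝓡 n)] {h : HermitianMetric n L}
  {D : CovariantDerivative (𝓡 n) ℂ L} {k : ℕ}

/-- The covariant derivative on the tensor power does not depend on the frame. -/
theorem tensorConnWith_eq_of_isFrameAt (hD : IsHermitianConnection h D) {e e' : Π x, L x} {x : M}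
    (he : IsFrameAt n e x) (he' : IsFrameAt n e' x) {t : Π x, TensorFiber L k x}
    (ht : MDifferentiableAt (𝓡 n) 𝓘(ℝ, ℂ) (frameCoord k e' t) x) (w : EuclideanSpace ℝ (Fin n)) :
    tensorConnWith (connOf D) k e t x w = tensorConnWith (connOf D) k e' t x w := by
  let u := sectionRatio e' e
  have hu : ContMDiffAt (𝓡 n) 𝓘(ℝ, ℂ) ∞ u x := he'.smooth.sectionRatio he.smooth he.2
  have hu1 : MDifferentiableAt (𝓡 n) 𝓘(ℝ, ℂ) u x := hu.mdifferentiableAt (by simp)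
  have heu : ∀ᶠ z in nhds x, e' z = u z • e z := by
    filter_upwards [he.eventually_ne_zero] with z hz
    exact (sectionRatio_smul hz).symm
  have hux : u x ≠ 0 := by
    intro h0
    have := heu.self_of_nhds
    rw [h0, zero_smul] at this
    exact he'.2 this
  have hf : frameCoord k e t =ᶠ[nhds x] fun z => frameCoord k e' t z * u z ^ k := by
    filter_upwards [heu, he'.eventually_ne_zero] with z hz hz0
    exact frameCoord_change (isLine_fiber z) hz0 hz
  obtain ⟨c, hc⟩ := (isLine_fiber x).exists_smul_eq he.2 (connOf D e x w)
  -- Under e' = ue the connection form c gains the logarithmic derivative du/u. In df + kcf this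
  -- cancels the derivative of u^k, which enters through f = f'u^k.
  have hc' : connOf D e' x w = (c + cderiv u x w / u x) • e' x := by
    rw [connOf_congr he'.smooth heu, connOf_smul hD he.smooth hu, hc, heu.self_of_nhds, smul_smul,
      smul_smul, ← add_smul]
    congr 1
    field_simp
  have huk : MDifferentiableAt (𝓡 n) 𝓘(ℝ, ℂ) (fun z => u z ^ k) x := hu1.pow k
  rw [tensorConnWith_eq _ _ _ _ hc, tensorConnWith_eq _ _ _ _ hc', cderiv_congr hf,
    cderiv_mul ht huk, hf.self_of_nhds, 
    framePow_congr (e := e') (e' := fun z => u z • e z) heu.self_of_nhds,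
    framePow_smul k u e x, smul_smul]
  congr 1
  have hp := cderiv_pow hu1 k w
  have hp' : cderiv (fun z => u z ^ k) x w = k * u x ^ k * cderiv u x w / u x := by
    rw [← hp]
    field_simp
  rw [hp']
  field_simp
  ring

theorem tensorConn_eq_of_isFrameAt (hD : IsHermitianConnection h D) {e : Π x, L x} {x : M}
    (he : IsFrameAt n e x) {t : Π x, TensorFiber L k x}
    (ht : MDifferentiableAt (𝓡 n) 𝓘(ℝ, ℂ) (frameCoord k e t) x) (w : EuclideanSpace ℝ (Fin n)) :
    tensorConn (connOf D) k t x w = tensorConnWith (connOf D) k e t x w :=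
  tensorConnWith_eq_of_isFrameAt hD (isFrameAt_chosenFrame n L x) he ht w

theorem IsSmoothTensorSection.mdifferentiableAt {t : Π x, TensorFiber L k x}
    (ht : IsSmoothTensorSection n k t) {e : Π x, L x} {x : M} (he : IsFrameAt n e x) :
    MDifferentiableAt (𝓡 n) 𝓘(ℝ, ℂ) (frameCoord k e t) x :=
  (ht x e he).mdifferentiableAt (by simp)

/-- The function z ↦ df(X z) is the vector component of the tangent map of f along the section X. -/
theorem contMDiffAt_cderiv {f : M → ℂ} {x : M}
    (hf : ∀ᶠ z in nhds x, ContMDiffAt (𝓡 n) 𝓘(ℝ, ℂ) ∞ f z) {X : M → EuclideanSpace ℝ (Fin n)}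
    (hX : ContMDiffAt (𝓡 n) ((𝓡 n).prod (𝓡 n)) ∞
      (fun z => TotalSpace.mk' (E := fun z : M => TangentSpace (𝓡 n) z)
        (EuclideanSpace ℝ (Fin n)) z (X z)) x) :
    ContMDiffAt (𝓡 n) 𝓘(ℝ, ℂ) ∞ (fun z => cderiv f z (X z)) x := by
  obtain ⟨U, hUf, hU, hxU⟩ := eventually_nhds_iff.1 hf
  have h1 := ContMDiffOn.contMDiffOn_tangentMapWithin (m := ∞)
    (fun z hz => (hUf z hz).contMDiffWithinAt) (by simp) hU.uniqueMDiffOn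
  let p : M → TangentBundle (𝓡 n) M := fun z => ⟨z, X z⟩
  have h2 : ContMDiffAt ((𝓡 n).prod (𝓡 n)) (𝓘(ℝ, ℂ).prod 𝓘(ℝ, ℂ)) ∞
      (tangentMapWithin (𝓡 n) 𝓘(ℝ, ℂ) f U) (p x) :=
    (h1 (p x) hxU).contMDiffAt
      ((hU.preimage (FiberBundle.continuous_proj _ _)).mem_nhds hxU)
  have h3 := (contMDiff_snd_tangentBundle_modelSpace ℂ 𝓘(ℝ, ℂ)).contMDiffAt.comp x (h2.comp x hX)
  refine h3.congr_of_eventuallyEq ?_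
  filter_upwards [hU.mem_nhds hxU] with z hz
  exact (DFunLike.congr_fun (mfderivWithin_of_isOpen (I := 𝓡 n) (I' := 𝓘(ℝ, ℂ)) (f := f) hU hz)
    (X z)).symm

/-- The covariant derivative of a smooth section along a smooth vector field is smooth. -/
theorem contMDiffAt_frameCoord_tensorConn (hD : IsHermitianConnection h D) {e : Π x, L x} {x : M}
    (he : IsFrameAt n e x) {t : Π x, TensorFiber L k x} (ht : IsSmoothTensorSection n k t)
    {X : M → EuclideanSpace ℝ (Fin n)}
    (hX : ContMDiffAt (𝓡 n) ((𝓡 n).prod (𝓡 n)) ∞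
      (fun z => TotalSpace.mk' (E := fun z : M => TangentSpace (𝓡 n) z)
        (EuclideanSpace ℝ (Fin n)) z (X z)) x) :
    ContMDiffAt (𝓡 n) 𝓘(ℝ, ℂ) ∞
      (frameCoord k e fun z => tensorConn (connOf D) k t z (X z)) x := by
  have h1 := (connOf_smooth hD he.1 hX).sectionRatio he.smooth he.2
  have h2 := contMDiffAt_cderiv (he.eventually.mono fun z hz => ht z e hz) hX
  -- In the frame `e` the coordinate of the covariant derivative is df(X) + kcf, with c the ratio of
  -- D_X e to e; all three ingredients are smooth.
  have h3 : ContMDiffAt (𝓡 n) 𝓘(ℝ, ℂ) ∞ (fun z => cderiv (frameCoord k e t) z (X z) +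
      k * sectionRatio (fun z => connOf D e z (X z)) e z * frameCoord k e t z) x :=
    h2.add (contMDiffAt_mul_complex (contMDiffAt_mul_complex contMDiffAt_const h1) (ht x e he))
  refine h3.congr_of_eventuallyEq ?_
  filter_upwards [he.eventually] with z hz
  refine frameCoord_eq (isLine_fiber z) hz.2 ?_
  rw [tensorConn_eq_of_isFrameAt hD hz (ht.mdifferentiableAt hz)]
  exact tensorConnWith_eq _ _ _ _ (sectionRatio_smul (s := fun z => connOf D e z (X z)) hz.2).symm

theorem tensorConnWith_add {e : Π x, L x} {x : M} (he : IsFrameAt n e x)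
    {t t' : Π x, TensorFiber L k x}
    (ht : MDifferentiableAt (𝓡 n) 𝓘(ℝ, ℂ) (frameCoord k e t) x)
    (ht' : MDifferentiableAt (𝓡 n) 𝓘(ℝ, ℂ) (frameCoord k e t') x) (w : EuclideanSpace ℝ (Fin n)) :
    tensorConnWith (connOf D) k e (t + t') x w =
      tensorConnWith (connOf D) k e t x w + tensorConnWith (connOf D) k e t' x w := by
  have hf : frameCoord k e (t + t') =ᶠ[nhds x]
      fun z => frameCoord k e t z + frameCoord k e t' z := by
    filter_upwards [he.eventually_ne_zero] with z hz
    exact frameCoord_add (isLine_fiber z) hz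
  rw [tensorConnWith, cderiv_congr hf, cderiv_add ht ht', hf.self_of_nhds, add_smul, add_smul,
    tensorConnWith, tensorConnWith]
  abel

theorem tensorConnWith_const_smul {e : Π x, L x} {x : M} (he : IsFrameAt n e x) (c : ℂ)
    {t : Π x, TensorFiber L k x}
    (ht : MDifferentiableAt (𝓡 n) 𝓘(ℝ, ℂ) (frameCoord k e t) x) (w : EuclideanSpace ℝ (Fin n)) :
    tensorConnWith (connOf D) k e (c • t) x w = c • tensorConnWith (connOf D) k e t x w := by
  have hf : frameCoord k e (c • t) =ᶠ[nhds x] fun z => c * frameCoord k e t z := by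
    filter_upwards [he.eventually_ne_zero] with z hz
    exact frameCoord_const_smul c (isLine_fiber z) hz
  rw [tensorConnWith, cderiv_congr hf, cderiv_const_mul c ht, hf.self_of_nhds, tensorConnWith,
    smul_add, smul_smul, smul_smul]

theorem IsSmoothTensorSection.add {t t' : Π x, TensorFiber L k x}
    (ht : IsSmoothTensorSection n k t) (ht' : IsSmoothTensorSection n k t') :
    IsSmoothTensorSection n k (t + t') := by
  intro x e he
  refine ((ht x e he).add (ht' x e he)).congr_of_eventuallyEq ?_
  filter_upwards [he.eventually_ne_zero] with z hz
  exact frameCoord_add (isLine_fiber z) hz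

theorem IsSmoothTensorSection.const_smul (c : ℂ) {t : Π x, TensorFiber L k x}
    (ht : IsSmoothTensorSection n k t) : IsSmoothTensorSection n k (c • t) := by
  intro x e he
  refine (contMDiffAt_mul_complex (contMDiffAt_const (c := c)) (ht x e he)).congr_of_eventuallyEq ?_
  filter_upwards [he.eventually_ne_zero] with z hz
  exact frameCoord_const_smul c (isLine_fiber z) hz

theorem tensorConn_add {t t' : Π x, TensorFiber L k x}
    {x : M} (ht : MDifferentiableAt (𝓡 n) 𝓘(ℝ, ℂ) (frameCoord k (chosenFrame n L x) t) x)
    (ht' : MDifferentiableAt (𝓡 n) 𝓘(ℝ, ℂ) (frameCoord k (chosenFrame n L x) t') x)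
    (w : EuclideanSpace ℝ (Fin n)) :
    tensorConn (connOf D) k (t + t') x w =
      tensorConn (connOf D) k t x w + tensorConn (connOf D) k t' x w :=
  tensorConnWith_add (isFrameAt_chosenFrame n L x) ht ht' w

theorem tensorConn_const_smul (c : ℂ) {t : Π x, TensorFiber L k x}
    {x : M} (ht : MDifferentiableAt (𝓡 n) 𝓘(ℝ, ℂ) (frameCoord k (chosenFrame n L x) t) x)
    (w : EuclideanSpace ℝ (Fin n)) :
    tensorConn (connOf D) k (c • t) x w = c • tensorConn (connOf D) k t x w :=
  tensorConnWith_const_smul (isFrameAt_chosenFrame n L x) c ht w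

variable {φ : OpenPartialHomeomorph M (EuclideanSpace ℝ (Fin n))}

theorem mdifferentiableAt_frameCoord_coordField (hD : IsHermitianConnection h D)
    (hφ : φ ∈ IsManifold.maximalAtlas (𝓡 n) ∞ M) {x : M} (hx : x ∈ φ.source) {e : Π x, L x}
    (he : IsFrameAt n e x) {t : Π x, TensorFiber L k x} (ht : IsSmoothTensorSection n k t)
    (j : Fin n) :
    MDifferentiableAt (𝓡 n) 𝓘(ℝ, ℂ)
      (frameCoord k e fun z => tensorConn (connOf D) k t z (coordField φ j z)) x :=
  (contMDiffAt_frameCoord_tensorConn hD he ht (contMDiffAt_coordField hφ j hx)).mdifferentiableAt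
    (by simp)

/-- Additivity is not formal, since `mfderiv` takes a default value at points of
non-differentiability. Smoothness makes both `t` and its covariant derivatives along coordinate
fields differentiable in frames. -/
theorem laplacianIn_add (g : MetricData n M) (hD : IsHermitianConnection h D)
    (hφ : φ ∈ IsManifold.maximalAtlas (𝓡 n) ∞ M) {x : M} (hx : x ∈ φ.source)
    {t t' : Π x, TensorFiber L k x} (ht : IsSmoothTensorSection n k t)
    (ht' : IsSmoothTensorSection n k t') :
    laplacianIn g (connOf D) k φ (t + t') x =
      laplacianIn g (connOf D) k φ t x + laplacianIn g (connOf D) k φ t' x := by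
  have h1 : ∀ z (w : EuclideanSpace ℝ (Fin n)), tensorConn (connOf D) k (t + t') z w =
      tensorConn (connOf D) k t z w + tensorConn (connOf D) k t' z w := fun z w =>
    tensorConn_add (ht.mdifferentiableAt (isFrameAt_chosenFrame n L z))
      (ht'.mdifferentiableAt (isFrameAt_chosenFrame n L z)) w
  have h2 : ∀ i j, tensorConn (connOf D) k
      (fun z => tensorConn (connOf D) k (t + t') z (coordField φ j z)) x (coordField φ i x) =
      tensorConn (connOf D) k
        (fun z => tensorConn (connOf D) k t z (coordField φ j z)) x (coordField φ i x) +
      tensorConn (connOf D) k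
        (fun z => tensorConn (connOf D) k t' z (coordField φ j z)) x (coordField φ i x) := by
    intro i j
    have : (fun z => tensorConn (connOf D) k (t + t') z (coordField φ j z)) =
      (fun z => tensorConn (connOf D) k t z (coordField φ j z)) +
      (fun z => tensorConn (connOf D) k t' z (coordField φ j z)) := funext fun z => h1 z _
    rw [this]
    exact tensorConn_add
      (mdifferentiableAt_frameCoord_coordField hD hφ hx (isFrameAt_chosenFrame n L x) ht j)
      (mdifferentiableAt_frameCoord_coordField hD hφ hx (isFrameAt_chosenFrame n L x) ht' j) _
  have h3 : ∀ l, tensorConn (connOf D) k (t + t') x (coordField φ l x) =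
      tensorConn (connOf D) k t x (coordField φ l x) +
        tensorConn (connOf D) k t' x (coordField φ l x) := fun l => h1 x _
  simp only [laplacianIn, h2, h3, smul_add, Finset.sum_add_distrib, add_sub_add_comm, neg_add]

theorem laplacianIn_const_smul (g : MetricData n M) (hD : IsHermitianConnection h D)
    (hφ : φ ∈ IsManifold.maximalAtlas (𝓡 n) ∞ M) {x : M} (hx : x ∈ φ.source) (c : ℂ)
    {t : Π x, TensorFiber L k x} (ht : IsSmoothTensorSection n k t) :
    laplacianIn g (connOf D) k φ (c • t) x = c • laplacianIn g (connOf D) k φ t x := by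
  have h1 : ∀ z (w : EuclideanSpace ℝ (Fin n)), tensorConn (connOf D) k (c • t) z w =
      c • tensorConn (connOf D) k t z w := fun z w =>
    tensorConn_const_smul c (ht.mdifferentiableAt (isFrameAt_chosenFrame n L z)) w
  have h2 : ∀ i j, tensorConn (connOf D) k
      (fun z => tensorConn (connOf D) k (c • t) z (coordField φ j z)) x (coordField φ i x) =
      c • tensorConn (connOf D) k
        (fun z => tensorConn (connOf D) k t z (coordField φ j z)) x (coordField φ i x) := by
    intro i j
    have : (fun z => tensorConn (connOf D) k (c • t) z (coordField φ j z)) =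
      c • (fun z => tensorConn (connOf D) k t z (coordField φ j z)) := funext fun z => h1 z _
    rw [this]
    exact tensorConn_const_smul c
      (mdifferentiableAt_frameCoord_coordField hD hφ hx (isFrameAt_chosenFrame n L x) ht j) _
  have h3 : ∀ l, tensorConn (connOf D) k (c • t) x (coordField φ l x) =
      c • tensorConn (connOf D) k t x (coordField φ l x) := fun l => h1 x _
  simp only [laplacianIn, h2, h3, smul_comm _ c, ← Finset.smul_sum, ← smul_sub, ← smul_neg]

/-- The space of sections `t` of the tensor power with `(Δ + Q) t = z t`. -/
def eigenspace (g : MetricData n M) (hD : IsHermitianConnection h D) (k : ℕ) (Q : M → ℝ) (z : ℂ) :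
    Submodule ℂ (Π x, TensorFiber L k x) where
  carrier := {t | IsEigensection g (connOf D) k Q z t}
  add_mem' {t t'} ht ht' := by
    refine ⟨ht.1.add ht'.1, fun φ hφ x hx => ?_⟩
    rw [laplacianIn_add g hD hφ hx ht.1 ht'.1, Pi.add_apply, smul_add, smul_add,
      ← ht.2 φ hφ x hx, ← ht'.2 φ hφ x hx]
    abel
  zero_mem' := by
    have h0 : IsSmoothTensorSection n k (0 : Π x, TensorFiber L k x) := by
      intro x e he
      refine (contMDiffAt_const (c := (0 : ℂ))).congr_of_eventuallyEq ?_
      filter_upwards [he.eventually_ne_zero] with z hz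
      exact frameCoord_eq (isLine_fiber z) hz (zero_smul ℂ _).symm
    refine ⟨h0, fun φ hφ x hx => ?_⟩
    -- The Laplacian of the zero section vanishes by homogeneity with factor 0.
    have := laplacianIn_const_smul g hD hφ hx 0 h0
    rw [zero_smul, zero_smul] at this
    rw [this, Pi.zero_apply, smul_zero, smul_zero, add_zero]
  smul_mem' c t ht := by
    refine ⟨ht.1.const_smul c, fun φ hφ x hx => ?_⟩
    rw [laplacianIn_const_smul g hD hφ hx c ht.1, Pi.smul_apply, smul_comm z c,
      ← ht.2 φ hφ x hx, smul_add, smul_comm c]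

end TensorConnection

/-! ## Local diffeomorphisms -/

section LocalDiffeomorph

variable {E₁ E₂ E₃ H₁ H₂ H₃ : Type*} [NormedAddCommGroup E₁] [NormedSpace ℝ E₁]
  [NormedAddCommGroup E₂] [NormedSpace ℝ E₂] [NormedAddCommGroup E₃] [NormedSpace ℝ E₃]
  [TopologicalSpace H₁] [TopologicalSpace H₂] [TopologicalSpace H₃]
  {I : ModelWithCorners ℝ E₁ H₁} {J : ModelWithCorners ℝ E₂ H₂} {K : ModelWithCorners ℝ E₃ H₃}
  {X Y Z : Type*} [TopologicalSpace X] [ChartedSpace H₁ X] [TopologicalSpace Y] [ChartedSpace H₂ Y]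
  [TopologicalSpace Z] [ChartedSpace H₃ Z] {p : X → Y}

theorem localInverse_apply_self {x : X} (hp : IsLocalDiffeomorphAt I J ∞ p x) :
    hp.localInverse (p x) = x :=
  hp.localInverse_left_inv hp.localInverse_mem_target

theorem contMDiffAt_comp_iff {x : X} (hp : IsLocalDiffeomorphAt I J ∞ p x) {u : Y → Z} :
    ContMDiffAt I K ∞ (fun z => u (p z)) x ↔ ContMDiffAt J K ∞ u (p x) := by
  refine ⟨fun h => ?_, fun h => ContMDiffAt.comp x h hp.contMDiffAt⟩
  have h1 : ContMDiffAt J K ∞ (fun y => u (p (hp.localInverse y))) (p x) :=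
    ContMDiffAt.comp_of_eq (g := fun z => u (p z)) h hp.localInverse_contMDiffAt
      (localInverse_apply_self hp)
  refine h1.congr_of_eventuallyEq ?_
  filter_upwards [hp.localInverse_eventuallyEq_right] with y hy
  exact congrArg u hy.symm

theorem mdifferentiableAt_comp_iff {x : X} (hp : IsLocalDiffeomorphAt I J ∞ p x) {u : Y → Z} :
    MDifferentiableAt I K (fun z => u (p z)) x ↔ MDifferentiableAt J K u (p x) := by
  refine ⟨fun h => ?_, fun h => MDifferentiableAt.comp x h (hp.mdifferentiableAt (by simp))⟩
  have h1 : MDifferentiableAt J K (fun y => u (p (hp.localInverse y))) (p x) :=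
    MDifferentiableAt.comp_of_eq (g := fun z => u (p z)) (p x) h
      (hp.localInverse_mdifferentiableAt (by simp)) (localInverse_apply_self hp)
  refine h1.congr_of_eventuallyEq ?_
  filter_upwards [hp.localInverse_eventuallyEq_right] with y hy
  exact congrArg u hy.symm

/-- No regularity of `u` is required: `u` is differentiable exactly when its composite with `p` is,
and otherwise both derivatives are the default 0. Metric coefficients and other functions downstairs
can thus be transferred without first proving them smooth. -/
theorem mfderiv_comp_of_isLocalDiffeomorphAt {x : X} (hp : IsLocalDiffeomorphAt I J ∞ p x)
    (u : Y → Z) :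
    mfderiv I K (fun z => u (p z)) x = (mfderiv J K u (p x)).comp (mfderiv I J p x) := by
  by_cases h : MDifferentiableAt J K u (p x)
  · exact mfderiv_comp x h (hp.mdifferentiableAt (by simp))
  · rw [mfderiv_zero_of_not_mdifferentiableAt h, mfderiv_zero_of_not_mdifferentiableAt
      (fun h' => h ((mdifferentiableAt_comp_iff hp).1 h'))]
    rfl

theorem eventually_comp_iff (hp : IsLocalDiffeomorph I J ∞ p) {x : X} {q : Y → Prop} :
    (∀ᶠ y in nhds (p x), q y) ↔ ∀ᶠ z in nhds x, q (p z) := by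
  rw [← hp.isLocalHomeomorph.map_nhds_eq, Filter.eventually_map]

end LocalDiffeomorph

/-! ## Local isomorphisms of line bundles -/

section Pullback

variable {M N : Type*} {L : M → Type*} [∀ x, AddCommGroup (L x)] [∀ x, Module ℂ (L x)] {k : ℕ}
  {V : N → Type*} [∀ y, AddCommGroup (V y)] [∀ y, Module ℂ (V y)] {p : M → N}

/-- The map of total spaces given by linear maps of the fibers. -/
def totalMap (P : ∀ x, L x ≃ₗ[ℂ] V (p x)) (v : TotalSpace ℂ L) : TotalSpace ℂ V :=
  ⟨p v.1, P v.1 v.2⟩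

/-- The pullback of a section. -/
def pullSection (P : ∀ x, L x ≃ₗ[ℂ] V (p x)) (s : Π y, V y) (x : M) : L x :=
  (P x).symm (s (p x))

/-- The map of the fibers of the tensor powers. -/
def tensorMap (P : ∀ x, L x ≃ₗ[ℂ] V (p x)) (k : ℕ) (x : M) :
    TensorFiber L k x ≃ₗ[ℂ] TensorFiber V k (p x) :=
  PiTensorProduct.congr fun _ => P x

/-- The pullback of a section of the tensor power. -/
def pullTensor (P : ∀ x, L x ≃ₗ[ℂ] V (p x)) (k : ℕ) :
    (Π y, TensorFiber V k y) →ₗ[ℂ] Π x, TensorFiber L k x where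
  toFun t x := (tensorMap P k x).symm (t (p x))
  map_add' t t' := by
    funext x
    simp
  map_smul' c t := by
    funext x
    simp

theorem tensorMap_pullTensor (P : ∀ x, L x ≃ₗ[ℂ] V (p x)) (t : Π y, TensorFiber V k y) (x : M) :
    tensorMap P k x (pullTensor P k t x) = t (p x) :=
  (tensorMap P k x).apply_symm_apply _

theorem pullTensor_injective (P : ∀ x, L x ≃ₗ[ℂ] V (p x)) (hp : Function.Surjective p) :
    Function.Injective (pullTensor P k) := by
  intro t t' htt'
  funext y
  obtain ⟨x, rfl⟩ := hp y
  rw [← tensorMap_pullTensor P t x, htt', tensorMap_pullTensor]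

variable (P : ∀ x, L x ≃ₗ[ℂ] V (p x))

theorem apply_pullSection (s : Π y, V y) (x : M) : P x (pullSection P s x) = s (p x) :=
  (P x).apply_symm_apply _

theorem tensorMap_framePow (e : Π y, V y) (x : M) :
    tensorMap P k x (framePow k (pullSection P e) x) = framePow k e (p x) := by
  simp only [tensorMap, framePow, PiTensorProduct.congr_tprod, apply_pullSection]

/-- The isomorphism of tensor fibers matches the two predicates defining the coordinates, so the
equality holds at every point, whether or not the frame vanishes there. -/
theorem frameCoord_pull (e : Π y, V y) (t : Π y, TensorFiber V k y) (x : M) :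
    frameCoord k (pullSection P e) (pullTensor P k t) x = frameCoord k e t (p x) := by
  rw [frameCoord_eq_chooseOrZero, frameCoord_eq_chooseOrZero]
  congr 1
  funext c
  rw [← (tensorMap P k x).injective.eq_iff, tensorMap_pullTensor, map_smul, tensorMap_framePow]

end Pullback

/-! ### Smooth sections and frames under a local isomorphism -/

section Transfer

variable {n : ℕ} {M : Type*} [TopologicalSpace M] [T2Space M]
  [ChartedSpace (EuclideanSpace ℝ (Fin n)) M] [IsManifold (𝓡 n) ∞ M]
  {L : M → Type*} [TopologicalSpace (TotalSpace ℂ L)]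
  [∀ x, AddCommGroup (L x)] [∀ x, Module ℂ (L x)] [∀ x, TopologicalSpace (L x)]
  [∀ x, IsTopologicalAddGroup (L x)] [∀ x, ContinuousSMul ℝ (L x)]
  [FiberBundle ℂ L] [VectorBundle ℂ ℂ L] [VectorBundle ℝ ℂ L]
  [ContMDiffVectorBundle ∞ ℂ L (𝓡 n)] {h : HermitianMetric n L}
  {D : CovariantDerivative (𝓡 n) ℂ L} {k : ℕ}
  {N : Type*} [TopologicalSpace N] [ChartedSpace (EuclideanSpace ℝ (Fin n)) N]
  [IsManifold (𝓡 n) ∞ N]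
  {V : N → Type*} [∀ y, AddCommGroup (V y)] [∀ y, Module ℂ (V y)]
  [TopologicalSpace (TotalSpace ℂ V)]
  [ChartedSpace (ModelProd (EuclideanSpace ℝ (Fin n)) ℂ) (TotalSpace ℂ V)]
  {p : M → N}

variable {P : ∀ x, L x ≃ₗ[ℂ] V (p x)} (hp : IsLocalDiffeomorph (𝓡 n) (𝓡 n) ∞ p)
  (hP : IsLocalDiffeomorph ((𝓡 n).prod 𝓘(ℝ, ℂ)) ((𝓡 n).prod 𝓘(ℝ, ℂ)) ∞ (totalMap P))

include hp hP in
-- Composing the pulled-back section with `totalMap P` gives s ∘ p. Conversely, a local inverse of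
-- `totalMap P` applied to s ∘ p is smooth, and near `x` it is the pulled-back section.
theorem smoothSectionAt_pull_iff {s : Π y, V y} {x : M} :
    SmoothSectionAt n (pullSection P s) x ↔ SmoothSectionAt n s (p x) := by
  have hcomp : (fun z => TotalSpace.mk' ℂ (p z) (s (p z))) =
      fun z => totalMap P (TotalSpace.mk' ℂ z (pullSection P s z)) := by
    funext z
    simp only [totalMap, apply_pullSection]
  have key : SmoothSectionAt n s (p x) ↔
      ContMDiffAt (𝓡 n) ((𝓡 n).prod 𝓘(ℝ, ℂ)) ∞ (fun z => TotalSpace.mk' ℂ (p z) (s (p z))) x :=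
    (contMDiffAt_comp_iff (hp x)).symm
  rw [key]
  constructor
  · intro hs
    rw [hcomp]
    exact ContMDiffAt.comp x (hP _).contMDiffAt hs
  · intro hs
    let v : TotalSpace ℂ L := ⟨x, pullSection P s x⟩
    have hv : totalMap P v = TotalSpace.mk' ℂ (p x) (s (p x)) := (congrFun hcomp x).symm
    have h1 : ContMDiffAt (𝓡 n) ((𝓡 n).prod 𝓘(ℝ, ℂ)) ∞
        (fun z => (hP v).localInverse (TotalSpace.mk' ℂ (p z) (s (p z)))) x :=
      ContMDiffAt.comp_of_eq (hP v).localInverse_contMDiffAt hs hv.symm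
    have hval : (hP v).localInverse (TotalSpace.mk' ℂ (p x) (s (p x))) = v := by
      rw [← hv, localInverse_apply_self]
    refine h1.congr_of_eventuallyEq ?_
    have h2 : ∀ᶠ z in nhds x, (hp x).localInverse (p z) = z := (hp x).localInverse_eventuallyEq_left
    have h3 : Filter.Tendsto
        (fun z => ((hP v).localInverse (TotalSpace.mk' ℂ (p z) (s (p z)))).proj)
        (nhds x) (nhds x) := by
      have := (FiberBundle.continuous_proj ℂ L).continuousAt.tendsto.comp h1.continuousAt.tendsto
      rwa [hval] at this
    have h4 : ∀ᶠ z in nhds x, totalMap P ((hP v).localInverse (TotalSpace.mk' ℂ (p z) (s (p z)))) =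
        TotalSpace.mk' ℂ (p z) (s (p z)) := by
      have := (hP v).localInverse_eventuallyEq_right
      rw [hv] at this
      exact hs.continuousAt.tendsto.eventually this
    -- The base point of the lifted vector and `z` are both close to `x` and have the same image
    -- under `p`. They coincide because `p` is injective near `x`, and then `P` is injective on the
    -- fiber.
    filter_upwards [h2, h3.eventually h2, h4] with z hz hz' hz4
    generalize (hP v).localInverse (TotalSpace.mk' ℂ (p z) (s (p z))) = w at hz' hz4
    have hw : p w.proj = p z := congrArg TotalSpace.proj hz4
    have hwz : w.proj = z := by rw [← hz', hw, hz]
    obtain ⟨y, w⟩ := w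
    obtain rfl : y = z := hwz
    have h5 : P y w = s (p y) := by simpa [totalMap] using hz4
    congr 1
    rw [pullSection, ← h5, LinearEquiv.symm_apply_apply]

include hp hP in
theorem isFrameAt_pull_iff {e : Π y, V y} {x : M} :
    IsFrameAt n (pullSection P e) x ↔ IsFrameAt n e (p x) := by
  refine and_congr ?_ (not_congr ?_)
  · rw [eventually_comp_iff hp]
    simp only [smoothSectionAt_pull_iff hp hP]
  · rw [pullSection, LinearEquiv.map_eq_zero_iff]

include hp in
variable (P) in
theorem exists_pullSection_eventuallyEq (s : Π x, L x) (x : M) :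
    ∃ s' : Π y, V y, ∀ᶠ z in nhds x, s z = pullSection P s' z := by
  classical
  let ψ := (hp x).localInverse
  -- The section is pushed forward along the local inverse `ψ` of `p`, and set to zero where `ψ`
  -- fails to be a section of `p`.
  refine ⟨fun y => if hy : p (ψ y) = y then hy ▸ P (ψ y) (s (ψ y)) else 0, ?_⟩
  filter_upwards [(hp x).localInverse_eventuallyEq_left] with z hz
  have hz' : ψ (p z) = z := hz
  have aux : ∀ (a : M) (_ : a = z) (ha : p a = p z),
      (ha ▸ P a (s a) : V (p z)) = P z (s z) := by
    rintro _ rfl _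
    rfl
  rw [pullSection, dif_pos (congrArg p hz'), aux _ hz', LinearEquiv.symm_apply_apply]

include hp hP in
theorem exists_isFrameAt_pull {e : Π x, L x} {x : M} (he : IsFrameAt n e x) :
    ∃ e' : Π y, V y, (∀ᶠ z in nhds x, e z = pullSection P e' z) ∧ IsFrameAt n e' (p x) := by
  obtain ⟨e', he'⟩ := exists_pullSection_eventuallyEq P hp e x
  refine ⟨e', he', (isFrameAt_pull_iff hp hP).1 ⟨?_, ?_⟩⟩
  · filter_upwards [he'.eventually_nhds, he.1] with z hz hz1
    exact hz1.congr hz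
  · rw [← he'.self_of_nhds]
    exact he.2

include hp hP in
-- No bundle structure on `V` is assumed. Frames of `L` pushed down show that the choice in
-- `chosenFrame` does not fall back on its default 0.
theorem isFrameAt_chosenFrame_of_pull (x : M) : IsFrameAt n (chosenFrame n V (p x)) (p x) := by
  obtain ⟨e, he⟩ := exists_isFrameAt (n := n) (L := L) x
  obtain ⟨e', -, he'⟩ := exists_isFrameAt_pull (P := P) hp hP he
  have hex : ∃ e : Π y, V y, IsFrameAt n e (p x) := ⟨e', he'⟩
  rw [chosenFrame, dif_pos hex]
  exact hex.choose_spec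

include hp hP in
theorem isSmoothTensorSection_pull_iff (hsurj : Function.Surjective p)
    {t : Π y, TensorFiber V k y} :
    IsSmoothTensorSection n k (pullTensor P k t) ↔ IsSmoothTensorSection n k t := by
  constructor
  · intro ht y e he
    obtain ⟨x, rfl⟩ := hsurj y
    have h1 := ht x _ ((isFrameAt_pull_iff hp hP).2 he)
    rw [← contMDiffAt_comp_iff (hp x)]
    simpa only [← frameCoord_pull P] using h1
  · intro ht x e he
    obtain ⟨e', hee', he'⟩ := exists_isFrameAt_pull (P := P) hp hP he
    have h1 := (contMDiffAt_comp_iff (hp x)).2 (ht (p x) e' he')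
    refine h1.congr_of_eventuallyEq ?_
    filter_upwards [hee'] with z hz
    rw [← frameCoord_pull P]
    exact frameCoord_congr hz rfl

end Transfer

/-! ### Coordinate fields, Gram matrix and Christoffel symbols under a local isometry -/

section TransferCoord

variable {n : ℕ} {M : Type*} [TopologicalSpace M] [ChartedSpace (EuclideanSpace ℝ (Fin n)) M]
  {N : Type*} [TopologicalSpace N] [ChartedSpace (EuclideanSpace ℝ (Fin n)) N]
  {p : M → N}

/-- The differential of a map. -/
def dmap (p : M → N) (x : M) : EuclideanSpace ℝ (Fin n) →L[ℝ] EuclideanSpace ℝ (Fin n) :=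
  mfderiv (𝓡 n) (𝓡 n) p x

theorem cderiv_comp (hp : IsLocalDiffeomorph (𝓡 n) (𝓡 n) ∞ p) (f : N → ℂ) (x : M)
    (w : EuclideanSpace ℝ (Fin n)) :
    cderiv (fun z => f (p z)) x w = cderiv f (p x) (dmap p x w) :=
  DFunLike.congr_fun (mfderiv_comp_of_isLocalDiffeomorphAt (K := 𝓘(ℝ, ℂ)) (hp x) f) w

variable {φ : OpenPartialHomeomorph M (EuclideanSpace ℝ (Fin n))}
  {φ' : OpenPartialHomeomorph N (EuclideanSpace ℝ (Fin n))}

/-- Here dφ = dφ' ∘ dp with dp invertible, and `inverse` is compatible with precomposition by an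
equivalence even if dφ' is not invertible. Thus neither chart needs to be assumed smooth. -/
theorem coordField_transfer (hp : IsLocalDiffeomorph (𝓡 n) (𝓡 n) ∞ p) {x : M}
    (hφ : ∀ᶠ z in nhds x, φ z = φ' (p z)) (i : Fin n) :
    coordField φ' i (p x) = dmap p x (coordField φ i x) := by
  let A : EuclideanSpace ℝ (Fin n) ≃L[ℝ] EuclideanSpace ℝ (Fin n) :=
    (hp x).mfderivToContinuousLinearEquiv (by simp)
  have hA : (A : EuclideanSpace ℝ (Fin n) →L[ℝ] EuclideanSpace ℝ (Fin n)) = dmap p x := rfl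
  let B : EuclideanSpace ℝ (Fin n) →L[ℝ] EuclideanSpace ℝ (Fin n) :=
    mfderiv (𝓡 n) (𝓡 n) φ' (p x)
  have hC : (mfderiv (𝓡 n) (𝓡 n) φ x : EuclideanSpace ℝ (Fin n) →L[ℝ] EuclideanSpace ℝ (Fin n)) =
      B.comp (A : EuclideanSpace ℝ (Fin n) →L[ℝ] EuclideanSpace ℝ (Fin n)) :=
    (Filter.EventuallyEq.mfderiv_eq hφ).trans
      (mfderiv_comp_of_isLocalDiffeomorphAt (K := 𝓡 n) (hp x) φ')
  have h1 : coordField φ i x =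
      (B.comp (A : EuclideanSpace ℝ (Fin n) →L[ℝ] EuclideanSpace ℝ (Fin n))).inverse
        (EuclideanSpace.single i (1 : ℝ)) := by
    rw [← hC]
    rfl
  rw [h1, ContinuousLinearMap.inverse_comp_equiv, ← hA]
  exact (A.apply_symm_apply _).symm

theorem coordDeriv_transfer (hp : IsLocalDiffeomorph (𝓡 n) (𝓡 n) ∞ p) {x : M}
    (hφ : ∀ᶠ z in nhds x, φ z = φ' (p z)) (i : Fin n) {u : N → ℝ} {v : M → ℝ}
    (huv : ∀ᶠ z in nhds x, v z = u (p z)) :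
    coordDeriv φ' i u (p x) = coordDeriv φ i v x := by
  have h1 : (mfderiv (𝓡 n) 𝓘(ℝ, ℝ) v x : EuclideanSpace ℝ (Fin n) →L[ℝ] ℝ) =
      (mfderiv (𝓡 n) 𝓘(ℝ, ℝ) u (p x) : EuclideanSpace ℝ (Fin n) →L[ℝ] ℝ).comp (dmap p x) :=
    (Filter.EventuallyEq.mfderiv_eq huv).trans
      (mfderiv_comp_of_isLocalDiffeomorphAt (K := 𝓘(ℝ, ℝ)) (hp x) u)
  have h2 := DFunLike.congr_fun h1 (coordField φ i x)
  rw [coordDeriv, coordField_transfer hp hφ]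
  exact h2.symm

variable {g : MetricData n M} {g' : MetricData n N}

theorem gram_transfer (hp : IsLocalDiffeomorph (𝓡 n) (𝓡 n) ∞ p)
    (hg : ∀ x v w, g' (p x) (dmap p x v) (dmap p x w) = g x v w) {x : M}
    (hφ : ∀ᶠ z in nhds x, φ z = φ' (p z)) :
    gram g' φ' (p x) = gram g φ x := by
  ext i j
  simp only [gram, Matrix.of_apply, coordField_transfer hp hφ]
  exact hg x _ _

theorem christoffel_transfer (hp : IsLocalDiffeomorph (𝓡 n) (𝓡 n) ∞ p)
    (hg : ∀ x v w, g' (p x) (dmap p x v) (dmap p x w) = g x v w) {x : M}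
    (hφ : ∀ᶠ z in nhds x, φ z = φ' (p z)) (l i j : Fin n) :
    christoffel g' φ' l i j (p x) = christoffel g φ l i j x := by
  have h1 : ∀ a b c, coordDeriv φ' a (fun z => gram g' φ' z b c) (p x) =
      coordDeriv φ a (fun z => gram g φ z b c) x := by
    intro a b c
    refine coordDeriv_transfer hp hφ a ?_
    -- The Gram matrices are differentiated, so they must agree on a neighborhood and not only at
    -- `x`.
    filter_upwards [hφ.eventually_nhds] with z hz
    rw [gram_transfer hp hg hz]
  simp only [christoffel, h1, gram_transfer hp hg hφ]

end TransferCoord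

/-! ### Local isomorphisms intertwine the connections and the Laplacians -/

section Transfer

variable {n : ℕ} {M : Type*} [TopologicalSpace M] [T2Space M]
  [ChartedSpace (EuclideanSpace ℝ (Fin n)) M] [IsManifold (𝓡 n) ∞ M]
  {L : M → Type*} [TopologicalSpace (TotalSpace ℂ L)]
  [∀ x, AddCommGroup (L x)] [∀ x, Module ℂ (L x)] [∀ x, TopologicalSpace (L x)]
  [∀ x, IsTopologicalAddGroup (L x)] [∀ x, ContinuousSMul ℝ (L x)]
  [FiberBundle ℂ L] [VectorBundle ℂ ℂ L] [VectorBundle ℝ ℂ L]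
  [ContMDiffVectorBundle ∞ ℂ L (𝓡 n)] {h : HermitianMetric n L}
  {D : CovariantDerivative (𝓡 n) ℂ L} {k : ℕ}
  {N : Type*} [TopologicalSpace N] [ChartedSpace (EuclideanSpace ℝ (Fin n)) N]
  [IsManifold (𝓡 n) ∞ N]
  {V : N → Type*} [∀ y, AddCommGroup (V y)] [∀ y, Module ℂ (V y)]
  [TopologicalSpace (TotalSpace ℂ V)]
  [ChartedSpace (ModelProd (EuclideanSpace ℝ (Fin n)) ℂ) (TotalSpace ℂ V)]
  {p : M → N}

/-- The maps `P x : L x → V (p x)` form a local isomorphism of line bundles with connection over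
Riemannian manifolds with a potential. -/
structure IsLocalIso (g : MetricData n M) (D : Conn n L) (Q : M → ℝ)
    (g' : MetricData n N) (D' : Conn n V) (Q' : N → ℝ) (P : ∀ x, L x ≃ₗ[ℂ] V (p x)) : Prop where
  surjective : Function.Surjective p
  base : IsLocalDiffeomorph (𝓡 n) (𝓡 n) ∞ p
  total : IsLocalDiffeomorph ((𝓡 n).prod 𝓘(ℝ, ℂ)) ((𝓡 n).prod 𝓘(ℝ, ℂ)) ∞ (totalMap P)
  metric (x : M) (v w : EuclideanSpace ℝ (Fin n)) : g' (p x) (dmap p x v) (dmap p x w) = g x v w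
  conn (s : Π y, V y) (x : M) (w : EuclideanSpace ℝ (Fin n)) :
    SmoothSectionAt n (pullSection P s) x → P x (D (pullSection P s) x w) = D' s (p x) (dmap p x w)
  potential (x : M) : Q' (p x) = Q x

namespace IsLocalIso

variable {g : MetricData n M} {Q : M → ℝ} {g' : MetricData n N} {D' : Conn n V} {Q' : N → ℝ}
  {P : ∀ x, L x ≃ₗ[ℂ] V (p x)}

theorem tensorConnWith_eq (H : IsLocalIso g (connOf D) Q g' D' Q' P) {e : Π y, V y} {x : M}
    (he : IsFrameAt n e (p x)) (t : Π y, TensorFiber V k y) (w : EuclideanSpace ℝ (Fin n)) :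
    tensorMap P k x (tensorConnWith (connOf D) k (pullSection P e) (pullTensor P k t) x w) =
      tensorConnWith D' k e t (p x) (dmap p x w) := by
  have h1 : frameCoord k (pullSection P e) (pullTensor P k t) = fun z => frameCoord k e t (p z) :=
    funext fun z => frameCoord_pull P e t z
  have h2 : SmoothSectionAt n (pullSection P e) x :=
    (smoothSectionAt_pull_iff H.base H.total).2 he.1.self_of_nhds
  have h3 : ∀ j : Fin k, tensorMap P k x (PiTensorProduct.tprod ℂ
      (Function.update (fun _ : Fin k => pullSection P e x) j
        (connOf D (pullSection P e) x w))) =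
      PiTensorProduct.tprod ℂ (Function.update (fun _ : Fin k => e (p x)) j
        (D' e (p x) (dmap p x w))) := by
    intro j
    rw [tensorMap, PiTensorProduct.congr_tprod]
    congr 1
    funext i
    by_cases hij : i = j
    · subst hij
      rw [Function.update_self, Function.update_self, H.conn e x w h2]
    · rw [Function.update_of_ne hij, Function.update_of_ne hij, apply_pullSection]
  rw [tensorConnWith, tensorConnWith, map_add, map_smul, map_smul, map_sum, tensorMap_framePow, h1,
    cderiv_comp H.base]
  simp only [h3]

/-- The frames chosen on `M` and on `N` are unrelated. Frame independence on `M` replaces the frame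
there by the pullback of the one chosen on `N`, so independence is never needed on `N`. -/
theorem tensorConn_eq (H : IsLocalIso g (connOf D) Q g' D' Q' P) (hD : IsHermitianConnection h D)
    {t : Π y, TensorFiber V k y} {x : M}
    (ht : ∀ e : Π x, L x, IsFrameAt n e x →
      MDifferentiableAt (𝓡 n) 𝓘(ℝ, ℂ) (frameCoord k e (pullTensor P k t)) x)
    (w : EuclideanSpace ℝ (Fin n)) :
    tensorMap P k x (tensorConn (connOf D) k (pullTensor P k t) x w) =
      tensorConn D' k t (p x) (dmap p x w) := by
  have he := isFrameAt_chosenFrame_of_pull (P := P) H.base H.total x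
  have he' := (isFrameAt_pull_iff H.base H.total).2 he
  rw [tensorConn_eq_of_isFrameAt hD he' (ht _ he'), H.tensorConnWith_eq he,
    LineBundleSunada.tensorConn_eq]

theorem laplacianIn_eq (H : IsLocalIso g (connOf D) Q g' D' Q' P) (hD : IsHermitianConnection h D)
    {t : Π y, TensorFiber V k y} (ht : IsSmoothTensorSection n k (pullTensor P k t))
    {φ : OpenPartialHomeomorph M (EuclideanSpace ℝ (Fin n))}
    {φ' : OpenPartialHomeomorph N (EuclideanSpace ℝ (Fin n))}
    (hφM : φ ∈ IsManifold.maximalAtlas (𝓡 n) ∞ M) {x : M} (hx : x ∈ φ.source)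
    (hφ : ∀ᶠ z in nhds x, φ z = φ' (p z)) :
    tensorMap P k x (laplacianIn g (connOf D) k φ (pullTensor P k t) x) =
      laplacianIn g' D' k φ' t (p x) := by
  have h1 : ∀ z (w : EuclideanSpace ℝ (Fin n)),
      tensorMap P k z (tensorConn (connOf D) k (pullTensor P k t) z w) =
        tensorConn D' k t (p z) (dmap p z w) := fun z w =>
    H.tensorConn_eq hD (fun e he => ht.mdifferentiableAt he) w
  have h2 : ∀ l, tensorMap P k x (tensorConn (connOf D) k (pullTensor P k t) x (coordField φ l x)) =
      tensorConn D' k t (p x) (coordField φ' l (p x)) := fun l =>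
    (h1 x (coordField φ l x)).trans
      (congrArg (tensorConn D' k t (p x)) (coordField_transfer H.base hφ l).symm)
  have h3 : ∀ i j, tensorMap P k x (tensorConn (connOf D) k
        (fun z => tensorConn (connOf D) k (pullTensor P k t) z (coordField φ j z)) x
          (coordField φ i x)) =
      tensorConn D' k (fun z => tensorConn D' k t z (coordField φ' j z)) (p x)
        (coordField φ' i (p x)) := by
    intro i j
    -- The charts correspond only near `x`, so the inner derivative is a pullback only there. That
    -- suffices for the outer derivative, which is local.
    have h4 : ∀ᶠ z in nhds x, tensorConn (connOf D) k (pullTensor P k t) z (coordField φ j z) =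
        pullTensor P k (fun z => tensorConn D' k t z (coordField φ' j z)) z := by
      filter_upwards [hφ.eventually_nhds] with z hz
      apply (tensorMap P k z).injective
      rw [tensorMap_pullTensor]
      exact (h1 z (coordField φ j z)).trans
        (congrArg (tensorConn D' k t (p z)) (coordField_transfer H.base hz j).symm)
    have h5 : tensorConn (connOf D) k
        (fun z => tensorConn (connOf D) k (pullTensor P k t) z (coordField φ j z)) x
          (coordField φ i x) = tensorConn (connOf D) k
            (pullTensor P k (fun z => tensorConn D' k t z (coordField φ' j z))) x
              (coordField φ i x) :=
      tensorConnWith_congr _ _ _ h4 _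
    rw [h5]
    refine (H.tensorConn_eq hD (fun e he => ?_) (coordField φ i x)).trans
      (congrArg (tensorConn D' k _ (p x)) (coordField_transfer H.base hφ i).symm)
    refine (mdifferentiableAt_frameCoord_coordField hD hφM hx he ht j).congr_of_eventuallyEq ?_
    filter_upwards [h4] with z hz
    exact frameCoord_congr rfl hz.symm
  simp only [laplacianIn, map_neg, map_sum, map_smul, map_sub, h2, h3,
    gram_transfer H.base H.metric hφ, christoffel_transfer H.base H.metric hφ]

end IsLocalIso

end Transfer

/-! ### Corresponding charts of the maximal atlases -/

section ChartTransfer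

variable {n : ℕ} {M : Type*} [TopologicalSpace M] [ChartedSpace (EuclideanSpace ℝ (Fin n)) M]
  {N : Type*} [TopologicalSpace N] [ChartedSpace (EuclideanSpace ℝ (Fin n)) N]
  [IsManifold (𝓡 n) ∞ M] [IsManifold (𝓡 n) ∞ N]

theorem trans_mem_maximalAtlas (Ψ : PartialDiffeomorph (𝓡 n) (𝓡 n) M N ∞)
    {φ : OpenPartialHomeomorph N (EuclideanSpace ℝ (Fin n))}
    (hφ : φ ∈ IsManifold.maximalAtlas (𝓡 n) ∞ N) :
    Ψ.toOpenPartialHomeomorph.trans φ ∈ IsManifold.maximalAtlas (𝓡 n) ∞ M := by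
  rw [IsManifold.mem_maximalAtlas_iff_contMDiffOn]
  exact ⟨(contMDiffOn_of_mem_maximalAtlas hφ).comp (Ψ.contMDiffOn.mono fun x hx => hx.1)
      fun x hx => hx.2,
    Ψ.contMDiffOn_invFun.comp ((contMDiffOn_symm_of_mem_maximalAtlas hφ).mono fun x hx => hx.1)
      fun x hx => hx.2⟩

variable {p : M → N} {x : M}

theorem exists_chart_pull (hp : IsLocalDiffeomorphAt (𝓡 n) (𝓡 n) ∞ p x)
    {φ' : OpenPartialHomeomorph N (EuclideanSpace ℝ (Fin n))}
    (hφ' : φ' ∈ IsManifold.maximalAtlas (𝓡 n) ∞ N) (hx : p x ∈ φ'.source) :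
    ∃ φ ∈ IsManifold.maximalAtlas (𝓡 n) ∞ M, x ∈ φ.source ∧ ∀ᶠ z in nhds x, φ z = φ' (p z) := by
  obtain ⟨Ψ, hxΨ, hΨ⟩ := hp
  refine ⟨_, trans_mem_maximalAtlas Ψ hφ', ⟨hxΨ, ?_⟩, ?_⟩
  · rwa [hΨ hxΨ] at hx
  · filter_upwards [Ψ.open_source.mem_nhds hxΨ] with z hz
    exact congrArg φ' (hΨ hz).symm

/-- The eigenvalue equation is required in all smooth charts on both sides, so charts must be moved
in both directions. -/
theorem exists_chart_push (hp : IsLocalDiffeomorphAt (𝓡 n) (𝓡 n) ∞ p x)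
    {φ : OpenPartialHomeomorph M (EuclideanSpace ℝ (Fin n))}
    (hφ : φ ∈ IsManifold.maximalAtlas (𝓡 n) ∞ M) (hx : x ∈ φ.source) :
    ∃ φ' ∈ IsManifold.maximalAtlas (𝓡 n) ∞ N, p x ∈ φ'.source ∧
      ∀ᶠ z in nhds x, φ z = φ' (p z) := by
  obtain ⟨Ψ, hxΨ, hΨ⟩ := hp
  have hinv : ∀ z ∈ Ψ.source, Ψ.symm (p z) = z := fun z hz => by
    rw [hΨ hz]
    exact Ψ.left_inv hz
  refine ⟨_, trans_mem_maximalAtlas Ψ.symm hφ, ⟨?_, ?_⟩, ?_⟩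
  · rw [hΨ hxΨ]
    exact Ψ.map_source hxΨ
  · change Ψ.symm (p x) ∈ φ.source
    rwa [hinv x hxΨ]
  · filter_upwards [Ψ.open_source.mem_nhds hxΨ] with z hz
    exact congrArg φ (hinv z hz).symm

end ChartTransfer

section Transfer

variable {n : ℕ} {M : Type*} [TopologicalSpace M] [T2Space M]
  [ChartedSpace (EuclideanSpace ℝ (Fin n)) M] [IsManifold (𝓡 n) ∞ M]
  {L : M → Type*} [TopologicalSpace (TotalSpace ℂ L)]
  [∀ x, AddCommGroup (L x)] [∀ x, Module ℂ (L x)] [∀ x, TopologicalSpace (L x)]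
  [∀ x, IsTopologicalAddGroup (L x)] [∀ x, ContinuousSMul ℝ (L x)]
  [FiberBundle ℂ L] [VectorBundle ℂ ℂ L] [VectorBundle ℝ ℂ L]
  [ContMDiffVectorBundle ∞ ℂ L (𝓡 n)] {h : HermitianMetric n L}
  {D : CovariantDerivative (𝓡 n) ℂ L} {k : ℕ}
  {N : Type*} [TopologicalSpace N] [ChartedSpace (EuclideanSpace ℝ (Fin n)) N]
  [IsManifold (𝓡 n) ∞ N]
  {V : N → Type*} [∀ y, AddCommGroup (V y)] [∀ y, Module ℂ (V y)]
  [TopologicalSpace (TotalSpace ℂ V)]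
  [ChartedSpace (ModelProd (EuclideanSpace ℝ (Fin n)) ℂ) (TotalSpace ℂ V)]
  {p : M → N}
  {g : MetricData n M} {Q : M → ℝ} {g' : MetricData n N} {D' : Conn n V} {Q' : N → ℝ}
  {P : ∀ x, L x ≃ₗ[ℂ] V (p x)}

/-- A section is an eigensection if and only if its pullback under a local isomorphism is. -/
theorem IsLocalIso.isEigensection_iff (H : IsLocalIso g (connOf D) Q g' D' Q' P)
    (hD : IsHermitianConnection h D) {z : ℂ} {t : Π y, TensorFiber V k y} :
    IsEigensection g (connOf D) k Q z (pullTensor P k t) ↔ IsEigensection g' D' k Q' z t := by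
  unfold IsEigensection
  rw [isSmoothTensorSection_pull_iff H.base H.total H.surjective]
  refine and_congr_right fun ht => ?_
  have ht' := (isSmoothTensorSection_pull_iff (P := P) H.base H.total H.surjective).2 ht
  have key : ∀ {φ : OpenPartialHomeomorph M (EuclideanSpace ℝ (Fin n))}
      {φ' : OpenPartialHomeomorph N (EuclideanSpace ℝ (Fin n))} {x : M},
      φ ∈ IsManifold.maximalAtlas (𝓡 n) ∞ M → x ∈ φ.source →
      (∀ᶠ z in nhds x, φ z = φ' (p z)) →
      (laplacianIn g (connOf D) k φ (pullTensor P k t) x + (Q x : ℂ) • pullTensor P k t x =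
          z • pullTensor P k t x ↔
        laplacianIn g' D' k φ' t (p x) + (Q' (p x) : ℂ) • t (p x) = z • t (p x)) := by
    intro φ φ' x hφM hx hφ
    rw [← (tensorMap P k x).injective.eq_iff, map_add, map_smul, map_smul, tensorMap_pullTensor,
      H.laplacianIn_eq hD ht' hφM hx hφ, H.potential]
  constructor
  · intro hE φ' hφ' y hy
    obtain ⟨x, rfl⟩ := H.surjective y
    obtain ⟨φ, hφM, hx, hφ⟩ := exists_chart_pull (H.base x) hφ' hy
    exact (key hφM hx hφ).1 (hE φ hφM x hx)
  · intro hE φ hφM x hx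
    obtain ⟨φ', hφ', hy, hφ⟩ := exists_chart_push (H.base x) hφM hx
    exact (key hφM hx hφ).2 (hE φ' hφ' (p x) hy)

end Transfer

/-! ## Quotient manifolds -/

section PushForwardCharts

variable {E H : Type*} [NormedAddCommGroup E] [NormedSpace ℝ E] [TopologicalSpace H]
  {I : ModelWithCorners ℝ E H} {X Y : Type*} [TopologicalSpace X] [ChartedSpace H X]
  [IsManifold I ∞ X] [TopologicalSpace Y] [ChartedSpace H Y] {f : X → Y}

/-- Two points in the same fiber of `f` are related by a smooth local deck transformation. -/
def HasLocalDeck (I : ModelWithCorners ℝ E H) (f : X → Y) : Prop :=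
  ∀ a b, f a = f b → ∃ τ : X → X, ContMDiffAt I I ∞ τ a ∧ τ a = b ∧ ∀ᶠ z in nhds a, f (τ z) = f z

/-- The charts of `Y` are the charts of `X`, transported by the local homeomorphism `f`. -/
def HasPushedCharts (H : Type*) [TopologicalSpace H] {X Y : Type*} [TopologicalSpace X]
    [ChartedSpace H X] [TopologicalSpace Y] [ChartedSpace H Y] {f : X → Y}
    (hf : IsLocalHomeomorph f) : Prop :=
  ∀ e ∈ atlas H Y, ∃ a : X, e = (hf.localInverseAt a).trans (chartAt H a)

/-- Near `x`, the branch of f⁻¹ at `b` composed with `f` is the local deck transformation τ: both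
take values in the domain where the branch inverts `f`, and f ∘ τ = f. -/
theorem contMDiffAt_localInverseAt_comp (hf : IsLocalHomeomorph f) (hτ : HasLocalDeck I f) {b x : X}
    (hx : f x ∈ (hf.localInverseAt b).source) :
    ContMDiffAt I I ∞ (fun z => hf.localInverseAt b (f z)) x := by
  obtain ⟨τ, h1, h2, h3⟩ := hτ x (hf.localInverseAt b (f x))
    (hf.apply_localInverseAt_of_mem hx).symm
  refine h1.congr_of_eventuallyEq ?_
  have h4 : ∀ᶠ z in nhds x, τ z ∈ (hf.localInverseAt b).target := by
    refine h1.continuousAt.eventually_mem ((hf.localInverseAt b).open_target.mem_nhds ?_)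
    rw [h2]
    exact (hf.localInverseAt b).map_source hx
  filter_upwards [h3, h4] with z hz hz'
  rw [← hz]
  have := (hf.localInverseAt b).right_inv hz'
  rwa [hf.localInverseAt_symm] at this

/-- A change of charts is a chart of `X`, composed with (branch of f⁻¹) ∘ f, composed with an
inverse chart of `X`; the middle factor is smooth by the deck property. -/
theorem isManifold_of_hasPushedCharts (hf : IsLocalHomeomorph f) (hτ : HasLocalDeck I f)
    (hc : HasPushedCharts H hf) : IsManifold I ∞ Y := by
  refine isManifold_of_contDiffOn I ∞ Y fun e e' he he' => ?_
  obtain ⟨a, rfl⟩ := hc e he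
  obtain ⟨b, rfl⟩ := hc e' he'
  rw [← contMDiffOn_iff_contDiffOn]
  rintro u ⟨hu, huI⟩
  obtain ⟨⟨hu1, hu2⟩, hu3⟩ := hu
  have hu1' : I.symm u ∈ (chartAt H a).target := hu1
  have hu3' : f ((chartAt H a).symm (I.symm u)) ∈ (hf.localInverseAt b).source := by
    have := hu3.1
    simpa using this
  have hu4' : hf.localInverseAt b (f ((chartAt H a).symm (I.symm u))) ∈ (chartAt H b).source := by
    have := hu3.2
    simpa using this
  have c1 : ContMDiffWithinAt 𝓘(ℝ, E) I ∞ I.symm (Set.range I) u := I.contMDiffOn_symm u huI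
  have c2 : ContMDiffAt I I ∞ (chartAt H a).symm (I.symm u) :=
    (contMDiffOn_chart_symm (x := a)).contMDiffAt ((chartAt H a).open_target.mem_nhds hu1')
  have c3 := contMDiffAt_localInverseAt_comp hf hτ hu3'
  have c4 : ContMDiffAt I I ∞ (chartAt H b)
      (hf.localInverseAt b (f ((chartAt H a).symm (I.symm u)))) :=
    (contMDiffOn_chart (x := b)).contMDiffAt ((chartAt H b).open_source.mem_nhds hu4')
  have c5 : ContMDiffAt I I ∞ (fun v => chartAt H b (hf.localInverseAt b (f v)))
      ((chartAt H a).symm (I.symm u)) :=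
    ContMDiffAt.comp (g := chartAt H b) (f := fun v => hf.localInverseAt b (f v)) _ c4 c3
  have c6 : ContMDiffAt I I ∞
      (fun v => chartAt H b (hf.localInverseAt b (f ((chartAt H a).symm v)))) (I.symm u) :=
    ContMDiffAt.comp (g := fun v => chartAt H b (hf.localInverseAt b (f v))) _ c5 c2
  have c7 := (I.contMDiff (n := ∞)).contMDiffAt.comp_contMDiffWithinAt u
    (c6.comp_contMDiffWithinAt u c1)
  refine (c7.mono Set.inter_subset_right).congr (fun y _ => ?_) ?_
  · simp
  · simp

theorem contMDiff_of_hasPushedCharts (hf : IsLocalHomeomorph f) (hτ : HasLocalDeck I f)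
    (hc : HasPushedCharts H hf) : ContMDiff I I ∞ f := by
  intro x
  rw [contMDiffAt_iff_target]
  refine ⟨hf.continuous.continuousAt, ?_⟩
  obtain ⟨a, ha⟩ := hc _ (chart_mem_atlas H (f x))
  have hx := mem_chart_source H (f x)
  rw [ha] at hx
  have c4 : ContMDiffAt I I ∞ (chartAt H a) (hf.localInverseAt a (f x)) :=
    (contMDiffOn_chart (x := a)).contMDiffAt ((chartAt H a).open_source.mem_nhds hx.2)
  have c5 := (I.contMDiff (n := ∞)).contMDiffAt.comp x
    (c4.comp x (contMDiffAt_localInverseAt_comp hf hτ hx.1))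
  refine c5.congr_of_eventuallyEq (Filter.Eventually.of_forall fun z => ?_)
  simp [extChartAt, ha]

theorem isLocalDiffeomorph_of_hasPushedCharts (hf : IsLocalHomeomorph f) (hτ : HasLocalDeck I f)
    (hc : HasPushedCharts H hf) : IsLocalDiffeomorph I I ∞ f := by
  have := isManifold_of_hasPushedCharts hf hτ hc
  intro x
  let Φ : PartialDiffeomorph I I X Y ∞ :=
    { toPartialEquiv := (hf.localInverseAt x).symm.toPartialEquiv
      open_source := (hf.localInverseAt x).open_target
      open_target := (hf.localInverseAt x).open_source
      contMDiffOn_toFun := by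
        have : ((hf.localInverseAt x).symm.toPartialEquiv : X → Y) = f := hf.localInverseAt_symm x
        change ContMDiffOn I I ∞ ((hf.localInverseAt x).symm.toPartialEquiv : X → Y) _
        rw [this]
        exact (contMDiff_of_hasPushedCharts hf hτ hc).contMDiffOn
      contMDiffOn_invFun := by
        intro y hy
        have hy' : y ∈ (hf.localInverseAt x).source := hy
        refine ContMDiffAt.contMDiffWithinAt ?_
        obtain ⟨a, ha⟩ := hc _ (chart_mem_atlas H y)
        have hya := mem_chart_source H y
        have h1 : ContMDiffAt I I ∞ (chartAt H y) y :=
          (contMDiffOn_chart (x := y)).contMDiffAt ((chartAt H y).open_source.mem_nhds hya)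
        rw [ha] at hya h1
        have h2 : ContMDiffAt I I ∞ (chartAt H a).symm
            (((hf.localInverseAt a).trans (chartAt H a)) y) :=
          (contMDiffOn_chart_symm (x := a)).contMDiffAt
            ((chartAt H a).open_target.mem_nhds ((chartAt H a).map_source hya.2))
        have h3 := h2.comp y h1
        -- The branch at `a` underlying the chart at `y` is smooth, being that chart followed by an
        -- inverse chart of `X`. The branch at `x` differs from it by (branch at x) ∘ f, which is
        -- smooth.
        have h4 : ContMDiffAt I I ∞ (hf.localInverseAt a) y := by
          refine h3.congr_of_eventuallyEq ?_
          filter_upwards [((hf.localInverseAt a).trans (chartAt H a)).open_source.mem_nhds hya]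
            with z hz
          exact ((chartAt H a).left_inv hz.2).symm
        have h5 : f (hf.localInverseAt a y) = y := hf.apply_localInverseAt_of_mem hya.1
        have h6 : ContMDiffAt I I ∞ (fun z => hf.localInverseAt x (f z)) (hf.localInverseAt a y) :=
          contMDiffAt_localInverseAt_comp hf hτ (by rwa [h5])
        refine (h6.comp y h4).congr_of_eventuallyEq ?_
        filter_upwards [(hf.localInverseAt a).open_source.mem_nhds hya.1] with z hz
        simp only [Function.comp_apply, hf.apply_localInverseAt_of_mem hz]
        rfl }
  refine ⟨Φ, hf.self_mem_localInverseAt_target, fun z _ => ?_⟩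
  exact (congrFun (hf.localInverseAt_symm x) z).symm

end PushForwardCharts

/-! ### Charts transported along a homeomorphism -/

section Homeomorph

variable {E H : Type*} [NormedAddCommGroup E] [NormedSpace ℝ E] [TopologicalSpace H]
  {I : ModelWithCorners ℝ E H} {X Y : Type*} [TopologicalSpace X] [ChartedSpace H X]
  [IsManifold I ∞ X] [TopologicalSpace Y]

theorem hasPushedCharts_chartedSpace {f : X → Y} (hf : IsLocalHomeomorph f)
    (hsurj : Function.Surjective f) :
    @HasPushedCharts H _ X Y _ _ _ (hf.chartedSpace hsurj) f hf := by
  rintro e ⟨q, rfl⟩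
  exact ⟨_, rfl⟩

theorem isLocalDiffeomorph_chartedSpace (f : X ≃ₜ Y) :
    letI := f.chartedSpace (H := H)
    IsLocalDiffeomorph I I ∞ f := by
  let := f.chartedSpace (H := H)
  refine isLocalDiffeomorph_of_hasPushedCharts f.isLocalHomeomorph ?_
    (hasPushedCharts_chartedSpace f.isLocalHomeomorph f.surjective)
  intro a b hab
  obtain rfl := f.injective hab
  exact ⟨id, contMDiffAt_id, rfl, Filter.Eventually.of_forall fun _ => rfl⟩

end Homeomorph

/-! ### Orbit spaces of free actions of finite groups -/

section Orbit

variable {E H : Type*} [NormedAddCommGroup E] [NormedSpace ℝ E] [TopologicalSpace H]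
  {I : ModelWithCorners ℝ E H} {X : Type*} [TopologicalSpace X] [ChartedSpace H X]
  [IsManifold I ∞ X] [T2Space X] [LocallyCompactSpace X]
  {Γ : Type*} [Group Γ] [Finite Γ] [MulAction Γ X] [ContinuousConstSMul Γ X] [IsCancelSMul Γ X]

/-- A finite group acting freely by homeomorphisms on a locally compact Hausdorff space acts
properly discontinuously, so the orbit map is a covering. -/
theorem isLocalHomeomorph_orbitMk :
    IsLocalHomeomorph (Quotient.mk (orbitRel Γ X)) :=
  isQuotientCoveringMap_quotientMk_of_properlyDiscontinuousSMul.isCoveringMap.isLocalHomeomorph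

theorem hasPushedCharts_orbitMk :
    HasPushedCharts H (isLocalHomeomorph_orbitMk (X := X) (Γ := Γ)) :=
  hasPushedCharts_chartedSpace _ Quotient.mk_surjective

theorem hasLocalDeck_orbitMk (hΓ : ∀ γ : Γ, ContMDiff I I ∞ (fun x : X => γ • x)) :
    HasLocalDeck I (Quotient.mk (orbitRel Γ X)) := by
  intro a b hab
  obtain ⟨γ, hγ⟩ := Quotient.exact hab.symm
  exact ⟨fun x => γ • x, (hΓ γ).contMDiffAt, hγ,
    Filter.Eventually.of_forall fun z => Quotient.sound ⟨γ, rfl⟩⟩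

theorem isManifold_orbit (hΓ : ∀ γ : Γ, ContMDiff I I ∞ (fun x : X => γ • x)) :
    IsManifold I ∞ (orbitRel.Quotient Γ X) :=
  isManifold_of_hasPushedCharts isLocalHomeomorph_orbitMk (hasLocalDeck_orbitMk hΓ)
    hasPushedCharts_orbitMk

theorem isLocalDiffeomorph_orbitMk (hΓ : ∀ γ : Γ, ContMDiff I I ∞ (fun x : X => γ • x)) :
    IsLocalDiffeomorph I I ∞
      (fun x : X => (Quotient.mk (orbitRel Γ X) x : orbitRel.Quotient Γ X)) :=
  isLocalDiffeomorph_of_hasPushedCharts isLocalHomeomorph_orbitMk (hasLocalDeck_orbitMk hΓ)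
    hasPushedCharts_orbitMk

end Orbit

/-! ## Functoriality of the pullback of tensors -/

section Functoriality

variable {M N K : Type*} {L : M → Type*} [∀ x, AddCommGroup (L x)] [∀ x, Module ℂ (L x)]
  {V : N → Type*} [∀ y, AddCommGroup (V y)] [∀ y, Module ℂ (V y)]
  {W : K → Type*} [∀ y, AddCommGroup (W y)] [∀ y, Module ℂ (W y)] {k : ℕ}
  {p : M → N}

/-- Base points such as (ab)x and a(bx) are equal without being identical terms. Comparing maps in
the total space keeps such transports out of the hypotheses; this lemma performs them once. -/
theorem congr_eq_of_mk_eq {X : Type*} [AddCommGroup X] [Module ℂ X] {y y' : N}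
    (A : X ≃ₗ[ℂ] V y) (B : X ≃ₗ[ℂ] V y')
    (hAB : ∀ v, (⟨y, A v⟩ : TotalSpace ℂ V) = ⟨y', B v⟩) (t : ⨂[ℂ] _i : Fin k, X) :
    ∀ hy : y = y', (hy ▸ (PiTensorProduct.congr (fun _ : Fin k => A) t : TensorFiber V k y) :
      TensorFiber V k y') = PiTensorProduct.congr (fun _ : Fin k => B) t := by
  rintro rfl
  have : A = B := LinearEquiv.ext fun v => by simpa using hAB v
  subst this
  rfl

theorem tensorMap_trans {p : M → N} {q : N → K} (P : ∀ x, L x ≃ₗ[ℂ] V (p x))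
    (R : ∀ y, V y ≃ₗ[ℂ] W (q y)) (x : M) (t : TensorFiber L k x) :
    tensorMap R k (p x) (tensorMap P k x t) =
      PiTensorProduct.congr (fun _ : Fin k => (P x).trans (R (p x))) t := by
  have h1 : (PiTensorProduct.congr (fun _ : Fin k => (P x).trans (R (p x)))).toLinearMap =
      (tensorMap R k (p x)).toLinearMap ∘ₗ (tensorMap P k x).toLinearMap := by
    ext v
    simp [tensorMap]
  exact (LinearMap.congr_fun h1 t).symm

theorem pullTensor_pullTensor {q : N → K} {r : M → K} (P : ∀ x, L x ≃ₗ[ℂ] V (p x))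
    (R : ∀ y, V y ≃ₗ[ℂ] W (q y)) (S : ∀ x, L x ≃ₗ[ℂ] W (r x))
    (hS : ∀ v, totalMap R (totalMap P v) = totalMap S v) (t : Π y, TensorFiber W k y) :
    pullTensor P k (pullTensor R k t) = pullTensor S k t := by
  funext x
  apply (tensorMap P k x).injective
  apply (tensorMap R k (p x)).injective
  rw [tensorMap_pullTensor, tensorMap_pullTensor, tensorMap_trans]
  have hx : r x = q (p x) := (congrArg TotalSpace.proj (hS ⟨x, 0⟩)).symm
  rw [← congr_eq_of_mk_eq (S x) ((P x).trans (R (p x))) (fun v => (hS ⟨x, v⟩).symm) _ hx]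
  have h2 : tensorMap S k x (pullTensor S k t x) = t (r x) := tensorMap_pullTensor S t x
  change t (q (p x)) = hx ▸ tensorMap S k x (pullTensor S k t x)
  rw [h2]
  clear h2
  generalize q (p x) = y at hx
  subst hx
  rfl

/-- Since P ∘ P = P on the total space, pulling back twice is pulling back once, and injectivity of
the pullback cancels one of them. -/
theorem pullTensor_of_totalMap_eq_self {p : M → M} (P : ∀ x, L x ≃ₗ[ℂ] L (p x))
    (hP : ∀ v, totalMap P v = v) (t : Π x, TensorFiber L k x) : pullTensor P k t = t := by
  have h1 := pullTensor_pullTensor P P P (fun v => by rw [hP v, hP v]) t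
  exact pullTensor_injective P (fun x => ⟨x, congrArg TotalSpace.proj (hP ⟨x, 0⟩)⟩) h1

/-- Descent: the value at y is read off at an arbitrary preimage. Two preimages are related by a
transformation R over the quotient that fixes t, so the choice does not matter. -/
theorem exists_pullTensor_eq (P : ∀ x, L x ≃ₗ[ℂ] V (p x)) (hp : Function.Surjective p)
    (t : Π x, TensorFiber L k x)
    (ht : ∀ x x', p x = p x' → ∃ (q : M → M) (R : ∀ x, L x ≃ₗ[ℂ] L (q x)), q x = x' ∧
      (∀ v, totalMap P (totalMap R v) = totalMap P v) ∧ pullTensor R k t = t) :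
    ∃ t', pullTensor P k t' = t := by
  refine ⟨fun y => Function.surjInv_eq hp y ▸ tensorMap P k _ (t (Function.surjInv hp y)), ?_⟩
  funext x
  apply (tensorMap P k x).injective
  rw [tensorMap_pullTensor]
  have aux : ∀ x' (hx : p x' = p x),
      (hx ▸ tensorMap P k x' (t x') : TensorFiber V k (p x)) = tensorMap P k x (t x) := by
    intro x' hx
    obtain ⟨q, R, rfl, h1, h2⟩ := ht x x' hx.symm
    have h3 : t (q x) = tensorMap R k x (t x) := by
      conv_rhs => rw [← h2]
      rw [tensorMap_pullTensor]
    rw [h3, tensorMap_trans]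
    exact congr_eq_of_mk_eq ((R x).trans (P (q x))) (P x) (fun v => h1 ⟨x, v⟩) (t x) hx
  exact aux _ _

/-- The linear maps of the fibers given by a fiberwise linear bijection of the total space. -/
theorem IsFiberwiseLinear.exists_linearEquiv {Φ : TotalSpace ℂ L → TotalSpace ℂ L} {φ : M → M}
    (h : IsFiberwiseLinear L Φ φ) (hΦ : Function.Bijective Φ) (hφ : Function.Injective φ) :
    ∃ P : ∀ x, L x ≃ₗ[ℂ] L (φ x), ∀ v, totalMap P v = Φ v := by
  choose A hA using h
  have hinj : ∀ x, Function.Injective (A x) := fun x v w hvw => by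
    have : Φ ⟨x, v⟩ = Φ ⟨x, w⟩ := by rw [hA, hA, hvw]
    simpa using hΦ.1 this
  have hsurj : ∀ x, Function.Surjective (A x) := fun x w => by
    obtain ⟨⟨y, v⟩, hv⟩ := hΦ.2 ⟨φ x, w⟩
    rw [hA] at hv
    obtain rfl : y = x := hφ (congrArg TotalSpace.proj hv)
    exact ⟨v, by simpa using hv⟩
  exact ⟨fun x => LinearEquiv.ofBijective (A x) ⟨hinj x, hsurj x⟩, fun v => (hA v.1 v.2).symm⟩

theorem IsFiberwiseLinear.symm {Φ : Equiv.Perm (TotalSpace ℂ L)} {φ : Equiv.Perm M}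
    (h : IsFiberwiseLinear L Φ φ) : IsFiberwiseLinear L Φ.symm φ.symm := by
  obtain ⟨P, hP⟩ := h.exists_linearEquiv Φ.bijective φ.injective
  intro x
  obtain ⟨y, rfl⟩ := φ.surjective x
  generalize hz : φ.symm (φ y) = z
  rw [φ.symm_apply_apply] at hz
  subst hz
  refine ⟨(P y).symm.toLinearMap, fun v => ?_⟩
  rw [Equiv.symm_apply_eq, ← hP]
  simp [totalMap]

end Functoriality

/-! ## The eigenspaces as representations -/

section EigenRepresentation

variable {n : ℕ} {M : Type*} [TopologicalSpace M] [T2Space M]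
  [ChartedSpace (EuclideanSpace ℝ (Fin n)) M] [IsManifold (𝓡 n) ∞ M]
  {L : M → Type*} [TopologicalSpace (TotalSpace ℂ L)]
  [∀ x, AddCommGroup (L x)] [∀ x, Module ℂ (L x)] [∀ x, TopologicalSpace (L x)]
  [∀ x, IsTopologicalAddGroup (L x)] [∀ x, ContinuousSMul ℝ (L x)]
  [FiberBundle ℂ L] [VectorBundle ℂ ℂ L] [VectorBundle ℝ ℂ L]
  [ContMDiffVectorBundle ∞ ℂ L (𝓡 n)] {h : HermitianMetric n L}
  {D : CovariantDerivative (𝓡 n) ℂ L}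
  {G : Type*} [Group G] [MulAction G M] [MulAction G (TotalSpace ℂ L)]
  {R : ∀ (a : G) (x : M), L x ≃ₗ[ℂ] L (a • x)}
  {g : MetricData n M} {Q : M → ℝ}

/-- The representation of `G` on an eigenspace. -/
def eigenRep (hD : IsHermitianConnection h D) (hR : ∀ a v, totalMap (R a) v = a • v)
    (hiso : ∀ a, IsLocalIso g (connOf D) Q g (connOf D) Q (R a)) (k : ℕ) (z : ℂ) :
    Representation ℂ G (eigenspace g hD k Q z) where
  -- Pullback is contravariant, hence the inverse.
  toFun a := (pullTensor (R a⁻¹) k).restrict fun _ ht => ((hiso a⁻¹).isEigensection_iff hD).2 ht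
  map_one' := by
    refine LinearMap.ext fun t => Subtype.ext ?_
    exact pullTensor_of_totalMap_eq_self _ (fun v => by rw [hR, inv_one, one_smul]) t.1
  map_mul' a b := by
    refine LinearMap.ext fun t => Subtype.ext ?_
    exact (pullTensor_pullTensor _ _ _
      (fun v => by rw [hR, hR, hR, mul_inv_rev, mul_smul]) t.1).symm

variable {N : Type*} [TopologicalSpace N] [ChartedSpace (EuclideanSpace ℝ (Fin n)) N]
  [IsManifold (𝓡 n) ∞ N]
  {V : N → Type*} [∀ y, AddCommGroup (V y)] [∀ y, Module ℂ (V y)]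
  [TopologicalSpace (TotalSpace ℂ V)]
  [ChartedSpace (ModelProd (EuclideanSpace ℝ (Fin n)) ℂ) (TotalSpace ℂ V)]
  {p : M → N} {g' : MetricData n N} {D' : Conn n V} {Q' : N → ℝ} {P : ∀ x, L x ≃ₗ[ℂ] V (p x)}

/-- The eigensections on a quotient by `Γ` correspond to the `Γ`-invariant eigensections. -/
theorem IsLocalIso.nonempty_linearEquiv_invariants (hD : IsHermitianConnection h D)
    (hR : ∀ a v, totalMap (R a) v = a • v)
    (hiso : ∀ a, IsLocalIso g (connOf D) Q g (connOf D) Q (R a))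
    (H : IsLocalIso g (connOf D) Q g' D' Q' P) (Γ : Subgroup G)
    (hΓ : ∀ γ ∈ Γ, ∀ v : TotalSpace ℂ L, totalMap P (γ • v) = totalMap P v)
    (htrans : ∀ x x', p x = p x' → ∃ γ ∈ Γ, γ • x = x') (k : ℕ) (z : ℂ) :
    Nonempty (Submodule.span ℂ {t : Π y, TensorFiber V k y | IsEigensection g' D' k Q' z t} ≃ₗ[ℂ]
      Representation.invariants ((eigenRep hD hR hiso k z).comp Γ.subtype)) := by
  -- By `IsLocalIso.isEigensection_iff` the eigensections downstairs are the preimage of a subspace,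
  -- so the span in `spec` adds nothing.
  let F : Submodule ℂ (Π y, TensorFiber V k y) := (eigenspace g hD k Q z).comap (pullTensor P k)
  have hF : Submodule.span ℂ {t : Π y, TensorFiber V k y | IsEigensection g' D' k Q' z t} = F := by
    have : {t : Π y, TensorFiber V k y | IsEigensection g' D' k Q' z t} = (F : Set _) :=
      Set.ext fun t => (H.isEigensection_iff hD).symm
    rw [this, Submodule.span_eq]
  rw [hF]
  let f₀ : F →ₗ[ℂ] eigenspace g hD k Q z := (pullTensor P k).restrict fun _ ht => ht
  let f : F →ₗ[ℂ] Representation.invariants ((eigenRep hD hR hiso k z).comp Γ.subtype) :=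
    f₀.codRestrict _ fun t γ => Subtype.ext <|
      pullTensor_pullTensor _ _ _ (fun v => by rw [hR]; exact hΓ _ (inv_mem γ.2) v) t.1
  refine ⟨LinearEquiv.ofBijective f ⟨fun t t' htt' => ?_, fun t => ?_⟩⟩
  · exact Subtype.ext (pullTensor_injective P H.surjective
      (congrArg (fun u => (u.1.1 : Π x, TensorFiber L k x)) htt'))
  · obtain ⟨t', ht'⟩ := exists_pullTensor_eq P H.surjective t.1.1 (fun x x' hxx' => by
      obtain ⟨γ, hγ, hx⟩ := htrans x x' hxx'
      refine ⟨_, R γ, hx, fun v => by rw [hR, hΓ γ hγ], ?_⟩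
      have h1 := congrArg Subtype.val (t.2 ⟨γ⁻¹, inv_mem hγ⟩)
      have h2 : pullTensor (R γ⁻¹⁻¹) k t.1.1 = t.1.1 := h1
      rwa [inv_inv] at h2)
    refine ⟨⟨t', ?_⟩, Subtype.ext (Subtype.ext ht')⟩
    change pullTensor P k t' ∈ eigenspace g hD k Q z
    rw [ht']
    exact t.1.2

end EigenRepresentation

/-! ## Bundle automorphisms -/

section LocalDiffeomorph

variable {E₁ E₂ E₃ H₁ H₂ H₃ : Type*} [NormedAddCommGroup E₁] [NormedSpace ℝ E₁]
  [NormedAddCommGroup E₂] [NormedSpace ℝ E₂] [NormedAddCommGroup E₃] [NormedSpace ℝ E₃]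
  [TopologicalSpace H₁] [TopologicalSpace H₂] [TopologicalSpace H₃]
  {I : ModelWithCorners ℝ E₁ H₁} {J : ModelWithCorners ℝ E₂ H₂} {K : ModelWithCorners ℝ E₃ H₃}
  {X Y Z : Type*} [TopologicalSpace X] [ChartedSpace H₁ X] [TopologicalSpace Y] [ChartedSpace H₂ Y]
  [TopologicalSpace Z] [ChartedSpace H₃ Z]

theorem isLocalDiffeomorph_comp {q : Y → Z} {p : X → Y} (hq : IsLocalDiffeomorph J K ∞ q)
    (hp : IsLocalDiffeomorph I J ∞ p) : IsLocalDiffeomorph I K ∞ (fun x => q (p x)) :=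
  fun x => IsLocalDiffeomorphAt.comp (hf := hp x) (hg := hq (p x))

theorem isLocalDiffeomorph_of_equiv (e : X ≃ Y) (h : ContMDiff I J ∞ e)
    (h' : ContMDiff J I ∞ e.symm) : IsLocalDiffeomorph I J ∞ e :=
  Diffeomorph.isLocalDiffeomorph ⟨e, h, h'⟩

end LocalDiffeomorph

/-! ### The fiber maps from L to its quotient -/

section Quotient

variable {M : Type*} (L : M → Type*) [∀ x, AddCommGroup (L x)] [∀ x, Module ℂ (L x)]
  (Γ : Type*) [Group Γ] [MulAction Γ M] [MulAction Γ (TotalSpace ℂ L)]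
  [IsLineBundleAction L Γ] [IsCancelSMul Γ M]

/-- The linear maps from the fibers of `L` to the fibers of `Γ\L`. -/
def quotEquiv (x : M) :
    L x ≃ₗ[ℂ] QuotFiber L Γ (Quotient.mk (orbitRel Γ M) x : orbitRel.Quotient Γ M) :=
  { fiberEquiv L Γ x _ rfl with
    map_add' := (fiberEquiv_linear L Γ x _ rfl).map_add
    map_smul' := (fiberEquiv_linear L Γ x _ rfl).map_smul }

variable {L Γ}

theorem quotEquiv_val (x : M) (v : L x) :
    (quotEquiv L Γ x v).1 = Quotient.mk _ (⟨x, v⟩ : TotalSpace ℂ L) :=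
  rfl

theorem totalMap_quotEquiv (v : TotalSpace ℂ L) :
    totalMap (quotEquiv L Γ) v = quotTotalSpaceEquiv L Γ (Quotient.mk _ v) :=
  rfl

theorem totalMap_quotEquiv_smul (γ : Γ) (v : TotalSpace ℂ L) :
    totalMap (quotEquiv L Γ) (γ • v) = totalMap (quotEquiv L Γ) v := by
  rw [totalMap_quotEquiv, totalMap_quotEquiv]
  exact congrArg _ (Quotient.sound ⟨γ, rfl⟩)

/-- Passing to the underlying orbits removes the dependence of the fiber on `q`, so no transport is
needed. -/
theorem section_val_congr (s : Π q, QuotFiber L Γ q) {q q' : orbitRel.Quotient Γ M} (h : q = q') :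
    (s q).1 = (s q').1 := by
  rw [h]

end Quotient

/-! ### Metric and connection on the quotient -/

section QuotientGeometry

variable {n : ℕ} {M : Type*} [TopologicalSpace M] [ChartedSpace (EuclideanSpace ℝ (Fin n)) M]
  [T2Space M] [LocallyCompactSpace M] [IsManifold (𝓡 n) ∞ M]
  {L : M → Type*} [TopologicalSpace (TotalSpace ℂ L)]
  [∀ x, AddCommGroup (L x)] [∀ x, Module ℂ (L x)] [∀ x, TopologicalSpace (L x)]
  [∀ x, IsTopologicalAddGroup (L x)] [∀ x, ContinuousSMul ℝ (L x)]
  [FiberBundle ℂ L] [VectorBundle ℂ ℂ L] [VectorBundle ℝ ℂ L]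
  [ContMDiffVectorBundle ∞ ℂ L (𝓡 n)]
  {Γ : Type*} [Group Γ] [Finite Γ] [MulAction Γ M] [MulAction Γ (TotalSpace ℂ L)]
  [ContinuousConstSMul Γ M] [ContinuousConstSMul Γ (TotalSpace ℂ L)]
  [IsLineBundleAction L Γ] [IsCancelSMul Γ M]

theorem isLocalDiffeomorph_totalMap_quotEquiv
    (hL : ∀ γ : Γ, ContMDiff ((𝓡 n).prod 𝓘(ℝ, ℂ)) ((𝓡 n).prod 𝓘(ℝ, ℂ)) ∞
      (fun v : TotalSpace ℂ L => γ • v)) :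
    IsLocalDiffeomorph ((𝓡 n).prod 𝓘(ℝ, ℂ)) ((𝓡 n).prod 𝓘(ℝ, ℂ)) ∞
      (totalMap (quotEquiv L Γ)) := by
  have h1 := isLocalDiffeomorph_orbitMk hL
  have := isManifold_orbit hL
  exact isLocalDiffeomorph_comp (q := quotTotalSpaceEquiv L Γ)
    (p := Quotient.mk (orbitRel Γ (TotalSpace ℂ L)))
    (isLocalDiffeomorph_chartedSpace (quotTotalSpaceEquiv L Γ).symm.homeomorph.symm) h1

variable (hM : ∀ γ : Γ, ContMDiff (𝓡 n) (𝓡 n) ∞ (fun x : M => γ • x))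

include hM in
-- The quotient data are defined at a chosen representative y = γx. Differentiating π ∘ γ = π shows
-- that passing from x down to the quotient and up to y is dγ, so invariance under γ removes the
-- choice.
theorem quotDerivInv_dmap {γ : Γ} {x y : M} (hy : γ • x = y) (w : EuclideanSpace ℝ (Fin n)) :
    ((mfderiv (𝓡 n) (𝓡 n) (Quotient.mk (orbitRel Γ M)) y :
      EuclideanSpace ℝ (Fin n) →L[ℝ] EuclideanSpace ℝ (Fin n)).inverse
        (dmap (fun x : M => (Quotient.mk (orbitRel Γ M) x : orbitRel.Quotient Γ M)) x w)) =
      dmap (fun x : M => γ • x) x w := by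
  subst hy
  have hπ := isLocalDiffeomorph_orbitMk hM
  let A : EuclideanSpace ℝ (Fin n) ≃L[ℝ] EuclideanSpace ℝ (Fin n) :=
    (hπ (γ • x)).mfderivToContinuousLinearEquiv (by simp)
  have hγ : IsLocalDiffeomorph (𝓡 n) (𝓡 n) ∞ (fun x : M => γ • x) :=
    isLocalDiffeomorph_of_equiv (MulAction.toPerm γ) (hM γ) (hM γ⁻¹)
  have h1 := mfderiv_comp_of_isLocalDiffeomorphAt (K := 𝓡 n) (hγ x)
    (fun x : M => (Quotient.mk (orbitRel Γ M) x : orbitRel.Quotient Γ M))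
  have h2 : (fun z : M => (Quotient.mk (orbitRel Γ M) (γ • z) : orbitRel.Quotient Γ M)) =
      fun z => Quotient.mk (orbitRel Γ M) z := funext fun z => Quotient.sound ⟨γ, rfl⟩
  rw [h2] at h1
  have h3 : dmap (fun x : M => (Quotient.mk (orbitRel Γ M) x : orbitRel.Quotient Γ M)) x w =
      A (dmap (fun x : M => γ • x) x w) := DFunLike.congr_fun h1 w
  rw [h3]
  change (A : EuclideanSpace ℝ (Fin n) →L[ℝ] EuclideanSpace ℝ (Fin n)).inverse _ = _
  rw [ContinuousLinearMap.inverse_equiv]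
  exact A.symm_apply_apply _

omit [T2Space M] [LocallyCompactSpace M] [Finite Γ] [ContinuousConstSMul Γ M] in
theorem exists_smul_eq_out (x : M) :
    ∃ γ : Γ, γ • x = (Quotient.mk (orbitRel Γ M) x : orbitRel.Quotient Γ M).out :=
  Quotient.exact (Quotient.out_eq (s := orbitRel Γ M) (Quotient.mk (orbitRel Γ M) x))

theorem quotMetric_dmap {g : ContMDiffRiemannianMetric (𝓡 n) ∞ (EuclideanSpace ℝ (Fin n))
      (fun x : M => TangentSpace (𝓡 n) x)} (hg : ∀ γ : Γ, IsSmoothIsometry g (fun x => γ • x))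
    (x : M) (v w : EuclideanSpace ℝ (Fin n)) :
    quotMetric Γ g (Quotient.mk (orbitRel Γ M) x)
      (dmap (fun x : M => (Quotient.mk (orbitRel Γ M) x : orbitRel.Quotient Γ M)) x v)
      (dmap (fun x : M => (Quotient.mk (orbitRel Γ M) x : orbitRel.Quotient Γ M)) x w) =
      g.inner x v w := by
  obtain ⟨γ, hγ⟩ := exists_smul_eq_out (Γ := Γ) x
  have hM := fun γ : Γ => (hg γ).1
  have key : ∀ y, γ • x = y → g.inner y (dmap (fun x : M => γ • x) x v)
      (dmap (fun x : M => γ • x) x w) = g.inner x v w := by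
    rintro _ rfl
    exact (hg γ).2 x v w
  have h1 := quotDerivInv_dmap hM hγ v
  have h2 := quotDerivInv_dmap hM hγ w
  rw [← key _ hγ, ← h1, ← h2]
  rfl

/-- Equivariance of lifts allows `PreservesConnection` to be applied with the same section as source
and target. -/
theorem smul_liftSection (s : Π q, QuotFiber L Γ q) (γ : Γ) (x : M) :
    γ • (⟨x, liftSection s x⟩ : TotalSpace ℂ L) = ⟨γ • x, liftSection s (γ • x)⟩ := by
  obtain ⟨A, hA⟩ := IsLineBundleAction.isFiberwiseLinear (L := L) γ x
  have h0 : γ • (⟨x, liftSection s x⟩ : TotalSpace ℂ L) = ⟨γ • x, A (liftSection s x)⟩ :=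
    hA (liftSection s x)
  have hval : ∀ y, Quotient.mk (orbitRel Γ (TotalSpace ℂ L)) ⟨y, liftSection s y⟩ =
      (s (Quotient.mk _ y)).1 := fun y =>
    congrArg Subtype.val ((fiberEquiv L Γ y _ rfl).apply_symm_apply (s (Quotient.mk _ y)))
  rw [h0]
  congr 1
  apply (quotEquiv L Γ (γ • x)).injective
  apply Subtype.ext
  rw [quotEquiv_val, quotEquiv_val, hval, ← h0,
    section_val_congr s (Quotient.sound ⟨γ, rfl⟩ : Quotient.mk (orbitRel Γ M) (γ • x) = _), ← hval]
  exact Quotient.sound ⟨γ, rfl⟩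

include hM in
theorem quotConn_val {D : CovariantDerivative (𝓡 n) ℂ L}
    (hD : ∀ γ : Γ, PreservesConnection D (fun v => γ • v) (fun x => γ • x))
    (s : Π q, QuotFiber L Γ q) {x : M} (hs : SmoothSectionAt n (liftSection s) x)
    (w : EuclideanSpace ℝ (Fin n)) {q : orbitRel.Quotient Γ M} (hq : Quotient.mk _ x = q) :
    (quotConn L Γ D s q
      (dmap (fun x : M => (Quotient.mk (orbitRel Γ M) x : orbitRel.Quotient Γ M)) x w)).1 =
      Quotient.mk _ (⟨x, D (liftSection s) x w⟩ : TotalSpace ℂ L) := by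
  subst hq
  obtain ⟨γ, hγ⟩ := exists_smul_eq_out (Γ := Γ) x
  have h1 := quotDerivInv_dmap hM hγ w
  have h2 := hD γ (liftSection s) (liftSection s) (smul_liftSection s γ) x w hs
  have key : ∀ y, γ • x = y → γ • (⟨x, D (liftSection s) x w⟩ : TotalSpace ℂ L) =
      ⟨y, D (liftSection s) y (dmap (fun x : M => γ • x) x w)⟩ := by
    rintro _ rfl
    exact h2
  have h3 := key _ hγ
  rw [← h1] at h3
  refine Quotient.sound ⟨γ, ?_⟩
  exact h3

/-- `L → Γ\L` is a local isomorphism. -/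
theorem isLocalIso_quot {g : ContMDiffRiemannianMetric (𝓡 n) ∞ (EuclideanSpace ℝ (Fin n))
      (fun x : M => TangentSpace (𝓡 n) x)} {D : CovariantDerivative (𝓡 n) ℂ L} {Q : M → ℝ}
    (hL : ∀ γ : Γ, ContMDiff ((𝓡 n).prod 𝓘(ℝ, ℂ)) ((𝓡 n).prod 𝓘(ℝ, ℂ)) ∞
      (fun v : TotalSpace ℂ L => γ • v))
    (hg : ∀ γ : Γ, IsSmoothIsometry g (fun x => γ • x))
    (hD : ∀ γ : Γ, PreservesConnection D (fun v => γ • v) (fun x => γ • x))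
    (hQ : ∀ (γ : Γ) (x : M), Q (γ • x) = Q x) :
    IsLocalIso (fun x v w => g.inner x v w) (connOf D) Q (quotMetric Γ g) (quotConn L Γ D)
      (quotFun Q hQ) (quotEquiv L Γ) where
  surjective := Quotient.mk_surjective
  base := isLocalDiffeomorph_orbitMk fun γ => (hg γ).1
  total := isLocalDiffeomorph_totalMap_quotEquiv hL
  metric := quotMetric_dmap hg
  conn s _ w hs := Subtype.ext (quotConn_val (fun γ => (hg γ).1) hD s hs w rfl).symm
  potential _ := rfl

end QuotientGeometry

/-! ## The local isomorphisms given by the group and by the bundle map -/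

section Actions

variable {n : ℕ} {M : Type*} [TopologicalSpace M] [ChartedSpace (EuclideanSpace ℝ (Fin n)) M]
  [T2Space M] [LocallyCompactSpace M] [IsManifold (𝓡 n) ∞ M]
  {L : M → Type*} [TopologicalSpace (TotalSpace ℂ L)]
  [∀ x, AddCommGroup (L x)] [∀ x, Module ℂ (L x)] [∀ x, TopologicalSpace (L x)]
  [∀ x, IsTopologicalAddGroup (L x)] [∀ x, ContinuousSMul ℝ (L x)]
  [FiberBundle ℂ L] [VectorBundle ℂ ℂ L] [VectorBundle ℝ ℂ L]
  [ContMDiffVectorBundle ∞ ℂ L (𝓡 n)]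
  {G : Type*} [Group G] [MulAction G M] [MulAction G (TotalSpace ℂ L)]
  {g : ContMDiffRiemannianMetric (𝓡 n) ∞ (EuclideanSpace ℝ (Fin n))
      (fun x : M => TangentSpace (𝓡 n) x)} {D : CovariantDerivative (𝓡 n) ℂ L} {Q : M → ℝ}

variable (L G) in
theorem exists_smulEquiv [IsLineBundleAction L G] :
    ∃ R : ∀ (a : G) (x : M), L x ≃ₗ[ℂ] L (a • x), ∀ a v, totalMap (R a) v = a • v := by
  choose R hR using fun a : G =>
    (IsLineBundleAction.isFiberwiseLinear (L := L) a).exists_linearEquiv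
      (MulAction.bijective a) (MulAction.injective a)
  exact ⟨R, hR⟩

theorem isLocalIso_smul {R : ∀ (a : G) (x : M), L x ≃ₗ[ℂ] L (a • x)}
    (hR : ∀ a v, totalMap (R a) v = a • v)
    (hL : ∀ a : G, ContMDiff ((𝓡 n).prod 𝓘(ℝ, ℂ)) ((𝓡 n).prod 𝓘(ℝ, ℂ)) ∞
      (fun v : TotalSpace ℂ L => a • v))
    (hg : ∀ a : G, IsSmoothIsometry g (fun x => a • x))
    (hD : ∀ a : G, PreservesConnection D (fun v => a • v) (fun x => a • x))
    (hQ : ∀ (a : G) (x : M), Q (a • x) = Q x) (a : G) :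
    IsLocalIso (fun x v w => g.inner x v w) (connOf D) Q (fun x v w => g.inner x v w) (connOf D) Q
      (R a) where
  surjective := MulAction.surjective a
  base := isLocalDiffeomorph_of_equiv (MulAction.toPerm a) (hg a).1 (hg a⁻¹).1
  total := by
    rw [funext (hR a)]
    exact isLocalDiffeomorph_of_equiv (MulAction.toPerm a) (hL a) (hL a⁻¹)
  metric := (hg a).2
  conn s x w hs := by
    -- The action of `a` carries the pulled-back section to `s`, which is the situation that
    -- `PreservesConnection` describes.
    have h1 := hD a (pullSection (R a) s) s (fun x => (hR a _).symm.trans (by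
      rw [totalMap, apply_pullSection])) x w hs
    have h2 := (hR a _).trans h1
    simpa [totalMap] using! h2
  potential := hQ a

variable {σ : BundleAut n L} {Γ₁ Γ₂ : Subgroup G} [IsLineBundleAction L G]
  [IsCancelSMul Γ₁ M] [IsCancelSMul Γ₂ M]

variable (Γ₁) in
/-- The composition of the inverse of the bundle map with the projection. -/
def symmQuotEquiv (S : ∀ x, L x ≃ₗ[ℂ] L (σ.base.symm x)) (x : M) :
    L x ≃ₗ[ℂ] QuotFiber L Γ₁ (Quotient.mk (orbitRel Γ₁ M) (σ.base.symm x)) :=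
  (S x).trans (quotEquiv L Γ₁ (σ.base.symm x))

theorem totalMap_symmQuotEquiv {S : ∀ x, L x ≃ₗ[ℂ] L (σ.base.symm x)}
    (hS : ∀ v, totalMap S v = σ.total.symm v) (v : TotalSpace ℂ L) :
    totalMap (symmQuotEquiv Γ₁ S) v = totalMap (quotEquiv L Γ₁) (σ.total.symm v) := by
  rw [← hS]
  rfl

theorem total_symmQuotEquiv_val (hσΓ : σ.Conjugates Γ₁ Γ₂)
    {S : ∀ x, L x ≃ₗ[ℂ] L (σ.base.symm x)} (hS : ∀ v, totalMap S v = σ.total.symm v)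
    (x : M) (v : L x) :
    hσΓ.total (symmQuotEquiv Γ₁ S x v).1 = Quotient.mk _ (⟨x, v⟩ : TotalSpace ℂ L) := by
  change Quotient.mk _ (σ.total (totalMap S ⟨x, v⟩)) = _
  rw [hS, Equiv.apply_symm_apply]

theorem base_symm_mk (hσΓ : σ.Conjugates Γ₁ Γ₂) (x : M) :
    hσΓ.base (Quotient.mk _ (σ.base.symm x)) = Quotient.mk _ x := by
  change Quotient.mk _ (σ.base (σ.base.symm x)) = _
  rw [Equiv.apply_symm_apply]

/-- Moving a section over M₁ to M₂ by σ and lifting it to M is the same as pulling it back along v ↦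
[σ⁻¹v]. Thus σ^*∇₂ is computed by D on the pulled-back section. -/
theorem liftSection_piCongr (hσΓ : σ.Conjugates Γ₁ Γ₂)
    {S : ∀ x, L x ≃ₗ[ℂ] L (σ.base.symm x)} (hS : ∀ v, totalMap S v = σ.total.symm v)
    (s : Π q, QuotFiber L Γ₁ q) :
    liftSection (hσΓ.base.piCongr hσΓ.fiber s) = pullSection (symmQuotEquiv Γ₁ S) s := by
  funext x
  refine (Equiv.symm_apply_eq _).2 (Subtype.ext ?_)
  rw [← section_val_congr (hσΓ.base.piCongr hσΓ.fiber s) (base_symm_mk hσΓ x),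
    Equiv.piCongr_apply_apply]
  change hσΓ.total (s (Quotient.mk _ (σ.base.symm x))).1 = Quotient.mk _ _
  rw [← apply_pullSection (symmQuotEquiv Γ₁ S) s x]
  exact total_symmQuotEquiv_val hσΓ hS x _

variable [Finite G] [ContinuousConstSMul G M] [ContinuousConstSMul G (TotalSpace ℂ L)]

/-- The connection and the potential on the target are themselves pulled back by σ, so they lift
along v ↦ [σ⁻¹v] to the original D and Q, although σ is not assumed to preserve either. The metric
on the target is that of M₁, and there σ has to be an isometry. -/
theorem isLocalIso_symmQuot (hσΓ : σ.Conjugates Γ₁ Γ₂) (hσ : IsSmoothIsometry g σ.base)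
    {S : ∀ x, L x ≃ₗ[ℂ] L (σ.base.symm x)} (hS : ∀ v, totalMap S v = σ.total.symm v)
    (hL : ∀ a : G, ContMDiff ((𝓡 n).prod 𝓘(ℝ, ℂ)) ((𝓡 n).prod 𝓘(ℝ, ℂ)) ∞
      (fun v : TotalSpace ℂ L => a • v))
    (hg : ∀ a : G, IsSmoothIsometry g (fun x => a • x))
    (hD : ∀ a : G, PreservesConnection D (fun v => a • v) (fun x => a • x))
    (hQ : ∀ (a : G) (x : M), Q (a • x) = Q x) :
    IsLocalIso (fun x v w => g.inner x v w) (connOf D) Q (quotMetric Γ₁ g)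
      (pullbackConn hσΓ.base hσΓ.fiber (quotConn L Γ₂ D))
      (quotFun Q (fun γ : Γ₂ => hQ γ) ∘ hσΓ.base) (symmQuotEquiv Γ₁ S) := by
  have hL₁ : ∀ γ : Γ₁, ContMDiff ((𝓡 n).prod 𝓘(ℝ, ℂ)) ((𝓡 n).prod 𝓘(ℝ, ℂ)) ∞
      (fun v : TotalSpace ℂ L => γ • v) := fun γ => hL γ
  have hg₁ : ∀ γ : Γ₁, IsSmoothIsometry g (fun x => γ • x) := fun γ => hg γ
  have hg₂ : ∀ γ : Γ₂, IsSmoothIsometry g (fun x => γ • x) := fun γ => hg γ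
  have hD₂ : ∀ γ : Γ₂, PreservesConnection D (fun v => γ • v) (fun x => γ • x) := fun γ => hD γ
  have hbase := isLocalDiffeomorph_of_equiv σ.base.symm σ.contMDiff_base_symm σ.contMDiff_base
  have hπ := isLocalDiffeomorph_orbitMk fun γ => (hg₁ γ).1
  have hp : IsLocalDiffeomorph (𝓡 n) (𝓡 n) ∞ (fun x : M =>
      (Quotient.mk (orbitRel Γ₁ M) (σ.base.symm x) : orbitRel.Quotient Γ₁ M)) :=
    isLocalDiffeomorph_comp hπ hbase
  refine ⟨Quotient.mk_surjective.comp σ.base.symm.surjective, hp, ?_, fun x v w => ?_,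
    fun s x w hs => ?_, fun x => ?_⟩
  · rw [funext (totalMap_symmQuotEquiv hS)]
    exact isLocalDiffeomorph_comp (isLocalDiffeomorph_totalMap_quotEquiv hL₁)
      (isLocalDiffeomorph_of_equiv σ.total.symm σ.contMDiff_total_symm σ.contMDiff_total)
  · have h1 : dmap (fun x : M =>
        (Quotient.mk (orbitRel Γ₁ M) (σ.base.symm x) : orbitRel.Quotient Γ₁ M)) x =
        (dmap (fun x : M => (Quotient.mk (orbitRel Γ₁ M) x : orbitRel.Quotient Γ₁ M))
          (σ.base.symm x)).comp (dmap σ.base.symm x) :=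
      mfderiv_comp_of_isLocalDiffeomorphAt (K := 𝓡 n) (hbase x)
        (fun x : M => (Quotient.mk (orbitRel Γ₁ M) x : orbitRel.Quotient Γ₁ M))
    -- The differentials of σ and σ⁻¹ are inverse to each other, so the isometry property passes
    -- from σ to σ⁻¹.
    have h2 : ContinuousLinearMap.id ℝ (EuclideanSpace ℝ (Fin n)) =
        (dmap σ.base (σ.base.symm x)).comp (dmap σ.base.symm x) := by
      have := mfderiv_comp_of_isLocalDiffeomorphAt (K := 𝓡 n) (hbase x) σ.base
      rw [funext σ.base.apply_symm_apply] at this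
      exact mfderiv_id.symm.trans this
    have h3 := hσ.2 (σ.base.symm x) (dmap σ.base.symm x v) (dmap σ.base.symm x w)
    rw [h1]
    refine (quotMetric_dmap hg₁ (σ.base.symm x) (dmap σ.base.symm x v)
      (dmap σ.base.symm x w)).trans (h3.symm.trans ?_)
    have key : ∀ y, y = x → g.inner y
        (((dmap σ.base (σ.base.symm x)).comp (dmap σ.base.symm x)) v)
        (((dmap σ.base (σ.base.symm x)).comp (dmap σ.base.symm x)) w) = g.inner x v w := by
      rintro _ rfl
      rw [← h2]
      rfl
    exact key _ (σ.base.apply_symm_apply x)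
  · rw [← liftSection_piCongr hσΓ hS] at hs ⊢
    refine (hσΓ.fiber _).injective (Subtype.ext ?_)
    -- This is the chain rule for the factorization of M → M₂ as x ↦ [σ⁻¹x] in M₁ followed by the
    -- induced map M₁ → M₂. Only the first factor needs to be known to be a local diffeomorphism.
    have h1 : dmap (fun x : M => (Quotient.mk (orbitRel Γ₂ M) x : orbitRel.Quotient Γ₂ M)) x w =
        dmap hσΓ.base (Quotient.mk (orbitRel Γ₁ M) (σ.base.symm x)) (dmap (fun x : M =>
        (Quotient.mk (orbitRel Γ₁ M) (σ.base.symm x) : orbitRel.Quotient Γ₁ M)) x w) := by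
      have := mfderiv_comp_of_isLocalDiffeomorphAt (K := 𝓡 n) (hp x) hσΓ.base
      rw [funext (base_symm_mk hσΓ)] at this
      exact DFunLike.congr_fun this w
    have h2 := quotConn_val (fun γ => (hg₂ γ).1) hD₂ _ hs w (base_symm_mk hσΓ x).symm
    refine (total_symmQuotEquiv_val hσΓ hS x _).trans (h2.symm.trans ?_)
    rw [h1]
    exact congrArg Subtype.val ((hσΓ.fiber _).apply_symm_apply _).symm
  · exact congrArg (quotFun Q _) (base_symm_mk hσΓ x)

end Actions

end LineBundleSunada

end

/-! ### The theorem: both spectra as dimensions of invariants -/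

open LineBundleSunada in
theorem corollary4p1
    -- a compact Riemannian manifold `(M, g)`
    {n : ℕ} {M : Type*} [TopologicalSpace M] [T2Space M] [CompactSpace M]
    [ChartedSpace (EuclideanSpace ℝ (Fin n)) M] [IsManifold (𝓡 n) ∞ M]
    (g : ContMDiffRiemannianMetric (𝓡 n) ∞ (EuclideanSpace ℝ (Fin n))
      (fun x : M => TangentSpace (𝓡 n) x))
    -- a Hermitian line bundle `L` over `M`
    {L : M → Type*} [TopologicalSpace (TotalSpace ℂ L)]
    [∀ x, AddCommGroup (L x)] [∀ x, Module ℂ (L x)] [∀ x, TopologicalSpace (L x)]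
    [∀ x, IsTopologicalAddGroup (L x)] [∀ x, ContinuousSMul ℝ (L x)]
    [FiberBundle ℂ L] [VectorBundle ℂ ℂ L] [VectorBundle ℝ ℂ L]
    [ContMDiffVectorBundle ∞ ℂ L (𝓡 n)] (h : HermitianMetric n L)
    -- a Hermitian connection on `L`
    (D : CovariantDerivative (𝓡 n) ℂ L) (hD : IsHermitianConnection h D)
    -- a finite group acting on `L` by bundle maps, preserving `D`, and by isometries on `M`
    {G : Type*} [Group G] [Finite G] [MulAction G M] [MulAction G (TotalSpace ℂ L)]
    [ContinuousConstSMul G M] [ContinuousConstSMul G (TotalSpace ℂ L)]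
    [IsLineBundleAction L G]
    (hG : ∀ a : G, ContMDiff ((𝓡 n).prod 𝓘(ℝ, ℂ)) ((𝓡 n).prod 𝓘(ℝ, ℂ)) ∞
      (fun v : TotalSpace ℂ L => a • v))
    (hGM : ∀ a : G, IsSmoothIsometry g (fun x => a • x))
    (hGD : ∀ a : G, PreservesConnection D (fun v => a • v) (fun x => a • x))
    -- almost conjugate subgroups whose actions on `M` are free
    (Γ₁ Γ₂ : Subgroup G) [IsCancelSMul Γ₁ M] [IsCancelSMul Γ₂ M]
    (hΓ : AlmostConjugate Γ₁ Γ₂)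
    -- a `G`-invariant potential
    (Q : M → ℝ) (hQ : ContMDiff (𝓡 n) 𝓘(ℝ, ℝ) ∞ Q) (hQG : ∀ (a : G) (x : M), Q (a • x) = Q x)
    -- a bundle map covering an isometry, normalizing `G` and conjugating `Γ₁` to `Γ₂`
    (σ : BundleAut n L) (hσ : IsSmoothIsometry g σ.base) (hσG : σ.Normalizes G)
    (hσΓ : σ.Conjugates Γ₁ Γ₂) :
    ∀ k : ℕ, 0 < k →
      spec (quotMetric Γ₁ g) (quotConn L Γ₁ D) k (quotFun Q fun γ : Γ₁ => hQG γ) =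
        spec (quotMetric Γ₁ g) (pullbackConn hσΓ.base hσΓ.fiber (quotConn L Γ₂ D)) k
          (quotFun Q (fun γ : Γ₂ => hQG γ) ∘ hσΓ.base) := by
  intro k _
  funext z
  obtain ⟨R, hR⟩ := exists_smulEquiv L G
  have hiso := isLocalIso_smul hR hG hGM hGD hQG
  obtain ⟨S, hS⟩ := σ.isFiberwiseLinear.symm.exists_linearEquiv σ.total.symm.bijective
    σ.base.symm.injective
  have := isManifold_orbit fun γ : Γ₁ => (hGM γ).1
  have H₁ := isLocalIso_quot (Γ := Γ₁) (fun γ => hG γ) (fun γ => hGM γ) (fun γ => hGD γ)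
    (fun γ => hQG γ)
  have H₂ := isLocalIso_symmQuot hσΓ hσ hS hG hGM hGD hQG
  obtain ⟨e₁⟩ := H₁.nonempty_linearEquiv_invariants hD hR hiso Γ₁
    (fun γ hγ v => totalMap_quotEquiv_smul (⟨γ, hγ⟩ : Γ₁) v) (fun x x' hx => by
      obtain ⟨γ, hγ⟩ := Quotient.exact hx.symm
      exact ⟨γ, γ.2, hγ⟩) k z
  obtain ⟨e₂⟩ := H₂.nonempty_linearEquiv_invariants hD hR hiso Γ₂ (fun γ hγ v => by
      rw [totalMap_symmQuotEquiv hS, totalMap_symmQuotEquiv hS, totalMap_quotEquiv,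
        totalMap_quotEquiv]
      -- The points σ⁻¹(γv) and σ⁻¹v lie in one Γ₁-orbit because σ carries Γ₁-orbits to Γ₂-orbits.
      refine congrArg _ (Quotient.sound ((hσΓ.orbitRel_total _ _).2 ?_))
      rw [Equiv.apply_symm_apply, Equiv.apply_symm_apply]
      exact ⟨⟨γ, hγ⟩, rfl⟩) (fun x x' hx => by
      have hx' : Quotient.mk (orbitRel Γ₂ M) x = Quotient.mk _ x' := by
        rw [← base_symm_mk hσΓ, ← base_symm_mk hσΓ, hx]
      obtain ⟨γ, hγ⟩ := Quotient.exact hx'.symm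
      exact ⟨γ, γ.2, hγ⟩) k z
  -- Both sides are invariants in one and the same representation of G on the eigenspace over M.
  exact e₁.rank_eq.trans ((hΓ.rank_invariants_eq _).trans e₂.rank_eq.symm)
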